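/- **Setting.** A (finite) 3D color code lattice is a 4-valent cellulation of a closed connected 3-manifold whose cells are colored with $\mathbf C=\{y,g,p,r\}$, adjacent cells having different colors; equivalently, a finite connected graph whose edges are properly colored with $\mathbf C$ (one edge of each color at each vertex), where the cells of color $c$ are the connected components of the graph of all edges of colors $\ne c$, the plaquettes are the components of the graph of all edges of two given colors, and the surface of every cell is a sphere (Euler characteristic $2$). An edge of color $c$ joins two cells of color $c$. Qubits sit on the vertices. Let $\{\mathbf c_1,\mathbf c_2,\mathbf c_3,\mathbf c_4\}=\mathbf C$ and let $K$ be the set of vertices on one side of a surface that intersects only edges of color $\mathbf c_4$. The *$X$-boundary code* has qubits $K$; its stabilizers are $\prod_{v\in C\cap K}X(v)$ for every cell $C$ that meets $K$ (the truncated $X$-stabilizer if $C$ is cut), and $\prod_{v\in f}Z(v)$ for every plaquette $f\subseteq K$ (the $Z$-stabilizers of cut plaquettes are removed). **Excitations.** A violated $X$-stabilizer of a cell of color $c$ is an electric charge $c_{\mathbf z}$; a violated $Z$-stabilizer of a plaquette between cells of colors $a,b$ is a piece of a flux line $(ab)_{\mathbf x}$. The excitation group is $A=A_e\times A_m$. Here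 $A_e$ is generated by the four $c_{\mathbf z}$, of order two, subject to $y_{\mathbf z}g_{\mathbf z}p_{\mathbf z}r_{\mathbf z}=1$; and $A_m$ is generated by the six $(ab)_{\mathbf x}$, of order two, subject to $(ab)_{\mathbf x}(ac)_{\mathbf x}(ad)_{\mathbf x}=1$ for $\{a,b,c,d\}=\mathbf C$ (both are $\cong\mathbb Z_2^3$). The *condensation group* of the boundary is the subgroup of $A$ generated by all pairs $(q,t)$ for which there are a Pauli operator on $K$ that commutes with all truncated stabilizers, and a cell $C$ meeting $K$, such that $q$ is the total charge that the operator creates on the uncut cells and $t$ is the total flux through the violated plaquettes of $C$, i.e. the flux that ends on the boundary at $C$ (it is trivial if $C$ is uncut). **Theorem.** There is an absolute constant $D$ such that for every such lattice, labelling of the colors and side $K$: 1. For all distinct $a,b\in\{\mathbf c_1,\mathbf c_2,\mathbf c_3\}$, every membrane operator for $(ab)_{\mathbf x}$ of the uncut lattice (a product of $X$ over a union of plaquettes with edges of colors $a,b$) terminates on the boundary: truncated to $K$ it commutes with all truncated stabilizers, and it violates the same intact stabilizers in $K$ as before. 2. If $K$ is not the whole lattice and contains at least one whole plaquette with $\mathbf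 c_4$-colored edges, then the condensation group is exactly the group generated by $(\mathbf c_2\mathbf c_3)_{\mathbf x}$, $(\mathbf c_1\mathbf c_3)_{\mathbf x}$, $(\mathbf c_1\mathbf c_2)_{\mathbf x}$. 3. The $X$-boundary code is equivalent, up to local unitaries and ancillas, to three copies of the 3D toric code with the all-smooth boundary $(m_1,m_2,m_3)$. The $i$-th copy ($i=1,2,3$) lives on the lattice in which the cells of color $\mathbf c_i$ are shrunk to points: its vertices are the $\mathbf c_i$-cells, its edges (the qubits) are the $\mathbf c_i$-edges in $K$, its faces are the plaquettes with $\mathbf c_i$-edges; it has truncated $X$-stabilizers on the vertices and the $Z$-stabilizers of all faces whose edges all lie in $K$. Equivalence means: after adding ancilla qubits in the state $|0\rangle$ to both sides, a circuit of at most $D$ layers of unitary gates (disjoint gates in each layer, each gate acting within one cell) conjugates the first stabilizer group onto the second one, the qubits of the two sides being identified by a bijection in which matched qubits lie in a common cell. -/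

import Mathlib

universe u

/-! ### Pauli operators and CSS stabilizer codes on finitely many qubits -/

section Qubits

variable {Q : Type*} [Fintype Q] [DecidableEq Q]

/-- Unitary operators on the Hilbert space of the qubits `Q`; the computational basis is labelled
by `Q → ZMod 2`. -/
abbrev QubitUnitary (Q : Type*) [Fintype Q] [DecidableEq Q] :=
  Matrix.unitaryGroup (Q → ZMod 2) ℂ

/-- The operator `∏ X(q)` over the qubits `q` with `x q = 1`. -/
def pauliX (x : Q → ZMod 2) : QubitUnitary Q :=
  ⟨Matrix.of fun s t => if s = t + x then 1 else 0, by
    rw [Matrix.mem_unitaryGroup_iff]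
    ext s t
    rw [Matrix.mul_apply, Finset.sum_eq_single (s - x)]
    · by_cases h : s = t
      · subst h; simp [Matrix.star_apply]
      · have h' : ¬ t = s := fun e => h e.symm
        simp [Matrix.star_apply, h, h']
    · intro b _ hb
      have h : ¬ s = b + x := fun e => hb (by rw [e]; simp)
      simp [h]
    · simp⟩

/-- The operator `∏ Z(q)` over the qubits `q` with `z q = 1`. -/
def pauliZ (z : Q → ZMod 2) : QubitUnitary Q :=
  ⟨Matrix.diagonal fun s => if ∑ q, z q * s q = 0 then 1 else -1, by
    rw [Matrix.mem_unitaryGroup_iff, Matrix.star_eq_conjTranspose,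
      Matrix.diagonal_conjTranspose, Matrix.diagonal_mul_diagonal, ← Matrix.diagonal_one]
    congr 1
    ext s
    by_cases h : ∑ q, z q * s q = 0 <;> simp [h]⟩

/-- A general Pauli operator (up to a phase). -/
def pauli (x z : Q → ZMod 2) : QubitUnitary Q := pauliX x * pauliZ z

/-- The operator `O` violates the stabilizer `S`: they anticommute, so `O` flips the sign of `S`. -/
def Violates (O S : QubitUnitary Q) : Prop :=
  (O : Matrix (Q → ZMod 2) (Q → ZMod 2) ℂ) * S = -(S * O : Matrix (Q → ZMod 2) (Q → ZMod 2) ℂ)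

/-- `U` acts as the identity outside the set `A` of qubits. -/
def SupportedOn (A : Set Q) (U : QubitUnitary Q) : Prop :=
  ∃ W : Matrix (A → ZMod 2) (A → ZMod 2) ℂ,
    (∀ s t : Q → ZMod 2, (∀ q, q ∉ A → s q = t q) →
      (U : Matrix (Q → ZMod 2) (Q → ZMod 2) ℂ) s t = W (fun q => s q) (fun q => t q)) ∧
    (∀ s t : Q → ZMod 2, (¬ ∀ q, q ∉ A → s q = t q) →
      (U : Matrix (Q → ZMod 2) (Q → ZMod 2) ℂ) s t = 0)

end Qubits

/-- The indicator function of a set of qubits, with values in `ZMod 2`. -/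
noncomputable def charVec {Q : Type*} (A : Set Q) : Q → ZMod 2 := A.indicator fun _ => 1

/-- A CSS code, given by the supports of its generating `X`- and `Z`-stabilizers. -/
structure CSSCode (Q : Type*) where
  xChecks : Set (Q → ZMod 2)
  zChecks : Set (Q → ZMod 2)

namespace CSSCode

/-- The stabilizer group. -/
def stabilizerGroup {Q : Type*} [Fintype Q] [DecidableEq Q] (S : CSSCode Q) :
    Subgroup (QubitUnitary Q) :=
  Subgroup.closure (pauliX '' S.xChecks ∪ pauliZ '' S.zChecks)

/-- Ancilla qubits, each in the state `|0⟩`. -/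
def ancilla (A : Type*) [DecidableEq A] : CSSCode A where
  xChecks := ∅
  zChecks := Set.range fun a => Pi.single a 1

/-- Two codes side by side. -/
def tensor {Q R : Type*} (S : CSSCode Q) (T : CSSCode R) : CSSCode (Q ⊕ R) where
  xChecks := (fun x => Sum.elim x 0) '' S.xChecks ∪ (fun x => Sum.elim 0 x) '' T.xChecks
  zChecks := (fun z => Sum.elim z 0) '' S.zChecks ∪ (fun z => Sum.elim 0 z) '' T.zChecks

/-- A family of codes side by side. -/
def tensorFamily {ι : Type*} {Q : ι → Type*} (S : ∀ i, CSSCode (Q i)) : CSSCode (Σ i, Q i) where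
  xChecks := {w | ∃ i, ∃ x ∈ (S i).xChecks, (∀ q, w ⟨i, q⟩ = x q) ∧
    ∀ j, j ≠ i → ∀ q, w ⟨j, q⟩ = 0}
  zChecks := {w | ∃ i, ∃ z ∈ (S i).zChecks, (∀ q, w ⟨i, q⟩ = z q) ∧
    ∀ j, j ≠ i → ∀ q, w ⟨j, q⟩ = 0}

/-- Relabelling of the qubits along a bijection. -/
def relabel {Q R : Type*} (e : Q ≃ R) (T : CSSCode R) : CSSCode Q where
  xChecks := (fun x => x ∘ e) '' T.xChecks
  zChecks := (fun z => z ∘ e) '' T.zChecks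

end CSSCode

/-! ### Local unitaries and local equivalence of codes

Qubits sit at sets of sites (`loc`), and `regions` is the family of those sets of sites that count
as local. -/

section Locality

variable {W : Type*} (regions : Set (Set W))

/-- One layer of a local circuit: a product of gates that act on pairwise disjoint sets of qubits,
the qubits of each gate lying in one local region. -/
def IsLocalLayer {Q : Type*} [Fintype Q] [DecidableEq Q] (loc : Q → Set W)
    (U : QubitUnitary Q) : Prop :=
  ∃ gates : List (Set Q × QubitUnitary Q),
    (gates.map Prod.fst).Pairwise Disjoint ∧
    (∀ g ∈ gates, SupportedOn g.1 g.2 ∧ ∃ R ∈ regions, ∀ q ∈ g.1, loc q ⊆ R) ∧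
    U = (gates.map Prod.snd).prod

/-- A local unitary of depth at most `D`. -/
def IsLocalUnitary (D : ℕ) {Q : Type*} [Fintype Q] [DecidableEq Q] (loc : Q → Set W)
    (U : QubitUnitary Q) : Prop :=
  ∃ layers : List (QubitUnitary Q), layers.length ≤ D ∧
    (∀ V ∈ layers, IsLocalLayer regions loc V) ∧ U = layers.prod

/-- Equivalence of codes up to local unitaries (of depth at most `D`) and ancillas: after ancilla
qubits in the state `|0⟩` have been placed at sites, on both sides, a local unitary carries
the first stabilizer group to the second one, where the qubits of the two sides are identified by
a bijection that moves no qubit out of its local region. -/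
def LocallyEquivalent (D : ℕ) {Q R : Type u} [Fintype Q] [DecidableEq Q] [Fintype R]
    [DecidableEq R] (locQ : Q → Set W) (S : CSSCode Q) (locR : R → Set W) (T : CSSCode R) : Prop :=
  ∃ (A B : Type u) (_ : Fintype A) (_ : DecidableEq A) (_ : Fintype B) (_ : DecidableEq B)
    (posA : A → W) (posB : B → W) (e : Q ⊕ A ≃ R ⊕ B) (U : QubitUnitary (Q ⊕ A)),
    (∀ q, ∃ Y ∈ regions, Sum.elim locQ (fun a => {posA a}) q ⊆ Y ∧
      Sum.elim locR (fun b => {posB b}) (e q) ⊆ Y) ∧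
    IsLocalUnitary regions D (Sum.elim locQ (fun a => {posA a})) U ∧
    (S.tensor (CSSCode.ancilla A)).stabilizerGroup.map (MulAut.conj U).toMonoidHom =
      ((T.tensor (CSSCode.ancilla B)).relabel e).stabilizerGroup

end Locality

/-! ### Toric codes with a smooth boundary -/

/-- The data of a lattice that enter the toric code: `ends v e ∈ {0, 1, 2}` is the number of ends
of the edge `e` at the vertex `v`, and `bdry f` is the set of edges around the face `f`. -/
structure ToricLattice where
  Vert : Type u
  Edge : Type u
  Face : Type u
  ends : Vert → Edge → ℕ
  bdry : Face → Set Edge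

/-- The toric code on the part of a lattice spanned by the set `E` of edges, with smooth
(`m`-) boundary: on the vertices the truncated `X`-stabilizers, and the `Z`-stabilizers of
exactly those faces that are intact. -/
noncomputable def ToricLattice.smoothCode (T : ToricLattice.{u}) (E : Set T.Edge) : CSSCode E where
  xChecks := Set.range fun (v : T.Vert) (e : E) => (T.ends v e : ZMod 2)
  zChecks := {z | ∃ f, T.bdry f ⊆ E ∧ z = fun e : E => charVec (T.bdry f) e}

/-! ### Color code lattices -/

/-- The four colors: yellow, green, purple, red. -/
inductive Color
  | y | g | p | r
  deriving DecidableEq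

instance : Fintype Color := ⟨{.y, .g, .p, .r}, fun c => by cases c <;> decide⟩

/-- A finite 4-valent graph whose edges are properly colored with the four colors: `nbr c v` is the
other end of the edge of color `c` at the vertex `v`. -/
structure ColoredGraph where
  Vertex : Type u
  [fintype : Fintype Vertex]
  [decEq : DecidableEq Vertex]
  nbr : Color → Vertex → Vertex
  nbr_nbr : ∀ c v, nbr c (nbr c v) = v
  nbr_ne : ∀ c v, nbr c v ≠ v

attribute [instance] ColoredGraph.fintype ColoredGraph.decEq

namespace ColoredGraph

variable (G : ColoredGraph.{u})

/-- The vertices that are reached from `v` along edges with colors in `S`. -/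
def residue (S : Finset Color) (v : G.Vertex) : Set G.Vertex :=
  {w | Relation.ReflTransGen (fun a b => ∃ c ∈ S, b = G.nbr c a) v w}

/-- The connected pieces of the graph of all edges with colors in `S`, as sets of vertices.
The edges of color `c` are the `{c}`-pieces, the plaquettes bounded by `a`- and `b`-colored edges
are the `{a, b}`-pieces, and the cells of color `c` are the `{c}ᶜ`-pieces: an edge of color
`c` joins two cells of color `c`, and a cell of color `c` is bounded by the other edges. -/
def Residue (S : Finset Color) : Type u := {A : Set G.Vertex // ∃ v, A = G.residue S v}

noncomputable instance (S : Finset Color) : Fintype (G.Residue S) := by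
  unfold Residue; exact Fintype.ofFinite _

noncomputable instance (S : Finset Color) : DecidableEq (G.Residue S) := Classical.decEq _

/-- The cell of color `c` that contains the vertex `v`. -/
abbrev cell (c : Color) (v : G.Vertex) : Set G.Vertex := G.residue {c}ᶜ v

/-- The number of `S`-pieces inside `A`. -/
noncomputable def countIn (S : Finset Color) (A : Set G.Vertex) : ℕ :=
  {B : G.Residue S | B.1 ⊆ A}.ncard

/-- The colored graph is the 1-skeleton of a 4-colored cellulation of a closed connected
3-manifold: it is connected, and the surface of every cell is a sphere (Euler's formula). -/
structure IsColorCodeLattice : Prop where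
  connected : ∀ v w : G.Vertex, w ∈ G.residue Finset.univ v
  spherical : ∀ c v, (G.cell c v).ncard + ∑ P ∈ Finset.powersetCard 2 {c}ᶜ,
    G.countIn P (G.cell c v) = ∑ i ∈ {c}ᶜ, G.countIn {i} (G.cell c v) + 2

/-! ### The cut and the boundary code -/

/-- `K` is one side of a surface that intersects only edges of color `c₄`. -/
def CutsOnly (c₄ : Color) (K : Finset G.Vertex) : Prop :=
  ∀ c, ∀ v ∈ K, G.nbr c v ∉ K → c = c₄

variable (K : Finset G.Vertex)

/-- The part in `K` of a set of vertices, as a vector of qubits. -/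
noncomputable def restrict (A : Set G.Vertex) : K → ZMod 2 := fun q => charVec A q

/-- The color code on the kept side `K` with an `X`-boundary: the `X`-stabilizers are those of all
cells that meet `K`, truncated if the cell is cut, and the `Z`-stabilizers are those of the
plaquettes that lie in `K` as a whole. -/
noncomputable def xBoundaryCode : CSSCode K where
  xChecks := {x | ∃ c, ∃ v ∈ K, x = G.restrict K (G.cell c v)}
  zChecks := {z | ∃ P : Finset Color, P.card = 2 ∧ ∃ v, G.residue P v ⊆ K ∧
    z = G.restrict K (G.residue P v)}

/-! ### Excitations -/

/-- Types of electric charges: sums of the charges `(c)_z`, modulo the fusion rule that one charge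
of each color fuse to the vacuum. -/
abbrev ChargeType :=
  (Color → ZMod 2) ⧸ Submodule.span (ZMod 2) {(fun _ => 1 : Color → ZMod 2)}

/-- Unordered pairs of distinct colors. -/
abbrev ColorPair := {P : Finset Color // P.card = 2}

/-- Types of magnetic flux: sums of the fluxes `(ab)_x`, modulo the fusion rule that
the three flux lines `(ab)_x`, `(ac)_x`, `(ad)_x`, which meet in cells of color `a`,
fuse to the vacuum. -/
abbrev FluxType :=
  (ColorPair → ZMod 2) ⧸ Submodule.span (ZMod 2)
    (Set.range fun (a : Color) (P : ColorPair) => if a ∈ P.1 then (1 : ZMod 2) else 0)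

/-- The group of the topological excitations of the color code, under fusion. -/
abbrev Excitation := ChargeType × FluxType

/-- The flux loop `(ab)_x`. -/
def fluxLoop (a b : Color) : Excitation :=
  (0, Submodule.Quotient.mk fun P => if P.1 = {a, b} then 1 else 0)

/-! ### Condensation -/

/-- The operator `O` creates no excitation on the boundary: it commutes with the
truncated stabilizers. -/
def NoBoundaryExcitation (O : QubitUnitary K) : Prop :=
  ∀ c, ∀ v ∈ K, ¬ G.cell c v ⊆ K → Commute O (pauliX (G.restrict K (G.cell c v)))

open Classical in
/-- The parity of the number of charges of each color that `O` creates on the intact cells. -/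
noncomputable def charges (O : QubitUnitary K) : Color → ZMod 2 := fun c =>
  ∑ C : G.Residue {c}ᶜ, if C.1 ⊆ K ∧ Violates O (pauliX (G.restrict K C.1)) then 1 else 0

open Classical in
/-- For a cell `C` of color `c`: the parity of the number of flux lines of each kind that `O`
creates through the plaquettes of `C`. A flux line of kind `P = {a, b}` runs through the violated
plaquettes between cells of the colors `a` and `b`. For an intact cell the total type is trivial
(flux lines do not end in the bulk); for a cut cell it is the type of
the flux that enters the boundary there. -/
noncomputable def fluxThrough (O : QubitUnitary K) (c : Color) (C : Set G.Vertex) :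
    ColorPair → ZMod 2 := fun P =>
  ∑ F : G.Residue P.1ᶜ, if c ∈ P.1 ∧ F.1 ⊆ C ∧ F.1 ⊆ K ∧
    Violates O (pauliZ (G.restrict K F.1)) then 1 else 0

/-- The group of the excitations that condense on the boundary. It is generated by the types of
excitations that a Pauli operator can emit from the boundary without leaving an
excitation on it: the total charge it creates in the bulk, together with the flux
that ends on the boundary at a given cell. -/
def condensationGroup : AddSubgroup Excitation :=
  AddSubgroup.closure {α | ∃ x z : K → ZMod 2, G.NoBoundaryExcitation K (pauli x z) ∧
    ∃ c, ∃ v ∈ K, α = (Submodule.Quotient.mk (G.charges K (pauli x z)),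
      Submodule.Quotient.mk (G.fluxThrough K (pauli x z) c (G.cell c v)))}

/-- The `X`-operator of the vector `x` in the uncut lattice terminates on the boundary: truncated to
`K`, it creates no excitation on the boundary, and elsewhere in `K` it creates
the same excitations as before. -/
def XTerminates (x : G.Vertex → ZMod 2) : Prop :=
  G.NoBoundaryExcitation K (pauliX fun q : K => x q) ∧
  (∀ c v, G.cell c v ⊆ K →
    (Violates (pauliX fun q : K => x q) (pauliX (G.restrict K (G.cell c v))) ↔
      Violates (pauliX x) (pauliX (charVec (G.cell c v))))) ∧
  ∀ (P : Finset Color) (v : G.Vertex), P.card = 2 → G.residue P v ⊆ K →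
    (Violates (pauliX fun q : K => x q) (pauliZ (G.restrict K (G.residue P v))) ↔
      Violates (pauliX x) (pauliZ (charVec (G.residue P v))))

/-- The membrane made of a set of plaquettes with edges of the colors `a` and `b`, which creates
`(ab)_x` flux loops. -/
noncomputable def membrane (a b : Color) (M : Set (G.Residue {a, b})) : G.Vertex → ZMod 2 :=
  charVec (⋃ F ∈ M, F.1)

/-! ### The three toric codes -/

/-- The lattice obtained by shrinking the cells of color `i` to points: its vertices are the cells
of color `i`, its edges are the edges of color `i`, and its faces are the plaquettes
that have edges of color `i`. -/
noncomputable def shrink (i : Color) : ToricLattice.{u} where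
  Vert := G.Residue {i}ᶜ
  Edge := G.Residue {i}
  Face := Σ P : {P : Finset Color // P.card = 2 ∧ i ∈ P}, G.Residue P.1
  ends C B := (C.1 ∩ B.1).ncard
  bdry F := {B | B.1 ⊆ F.2.1}

/-- The edges of the shrunk lattice on the kept side. -/
def keptEdges (i : Color) : Set (G.shrink i).Edge := {B | B.1 ⊆ K}

/-- The qubits of the three toric codes: the kept edges of the colors other than `c₄`. -/
def ToricQubit (c₄ : Color) : Type u := Σ i : {i : Color // i ≠ c₄}, G.keptEdges K i.1

noncomputable instance (c₄ : Color) : Fintype (G.ToricQubit K c₄) := by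
  have (i : Color) : Finite (G.keptEdges K i) := by
    have : Finite (G.shrink i).Edge := inferInstanceAs (Finite (G.Residue {i}))
    infer_instance
  unfold ToricQubit
  exact Fintype.ofFinite _

noncomputable instance (c₄ : Color) : DecidableEq (G.ToricQubit K c₄) := Classical.decEq _

/-- Three copies of the toric code with the boundary `(m₁, m₂, m₃)`: the toric codes on the
lattices in which the cells of one color other than `c₄` are shrunk, each with smooth boundary. -/
noncomputable def threeSmoothToricCodes (c₄ : Color) : CSSCode (G.ToricQubit K c₄) :=
  CSSCode.tensorFamily fun i => (G.shrink i.1).smoothCode (G.keptEdges K i.1)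

/-- Position of a qubit of the toric codes: the ends of its edge. -/
def toricLoc (c₄ : Color) (b : G.ToricQubit K c₄) : Set K := {w | w.1 ∈ b.2.1.1}

/-- The local regions: the cells, as far as they are kept. -/
def localRegions : Set (Set K) := {R | ∃ c v, R = {w | w.1 ∈ G.cell c v}}

end ColoredGraph

/-! Over `ZMod 2` all three claims become linear algebra. Every truncated stabilizer is of `X`-type
and every remaining `Z`-check lies inside `K`. Hence any `X`-operator whatsoever commutes with the
truncated stabilizers, and its truncation has the same overlap with each intact plaquette; this is
`xTerminates`.

Condensation. If the `Z`-part of a Pauli operator disturbs no cut cell, the parity of the charges of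
color `c` is the parity of its whole support. This does not depend on `c`, so the charge is killed
by the fusion rule (`charges_eq`). The flux is linear in the `X`-part, so only the flux of a single
`X(v)` matters. At a cell of color `i`, such an `X(v)` meets three plaquettes; if all are intact,
the flux is a fusion relation, and each cut plaquette changes it by its own loop (`mk_vertexFlux`).
Hence only loops of colors other than `c₄` occur. All of them occur, because connectivity provides
both a vertex with every `c₄`-plaquette cut and a vertex with some but not all cut.

Unfolding. Write `d` for `c₄`. The set `K` is a union of `d`-cells, and each edge of another color
lies in one such cell. Let `edgeSums` send a vector on the vertices of `K` to its coboundary on the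
kept edges of the three other colors. Its kernel consists of the vectors constant on `d`-cells, i.e.
the span of the `X`-stabilizers of these cells. The remaining cell stabilizers go to the vertex
stabilizers of the toric codes, and face conditions pull back to plaquette conditions. Its image
contains every vector satisfying all toric face conditions, because the surfaces of the `d`-cells
are spheres (`exists_potential`, a dimension count from Euler's formula).

Together with `pointValues`, one value per `d`-cell, the coboundary becomes an injective map that
acts cell by cell. `locallyEquivalent_of_blockwise` turns such a map into a circuit of three layers:
one shear writes the image into ancillas, a second erases the input by a left inverse, and Hadamard
gates convert the `|+⟩` ancillas left by the `d`-cell stabilizers into `|0⟩`. -/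

/-! ### Pauli algebra -/

section PauliAlgebra

variable {Q : Type*} [Fintype Q] [DecidableEq Q]

/-- The sign `(-1)^a`. -/
def signChar (a : ZMod 2) : ℂ := if a = 0 then 1 else -1

theorem signChar_zero : signChar 0 = 1 := by simp [signChar]

theorem zmod_two_cases (a : ZMod 2) : a = 0 ∨ a = 1 := by
  revert a; decide

theorem signChar_add (a b : ZMod 2) : signChar (a + b) = signChar a * signChar b := by
  have h2 : (1 : ZMod 2) + 1 = 0 := by decide
  rcases zmod_two_cases a with rfl | rfl <;> rcases zmod_two_cases b with rfl | rfl <;>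
    simp [signChar, h2]

theorem add_self_zmod_two {ι : Type*} (x : ι → ZMod 2) : x + x = 0 :=
  funext fun _ => CharTwo.add_self_eq_zero _

theorem pauliX_apply (x s t : Q → ZMod 2) :
    (pauliX x : Matrix (Q → ZMod 2) (Q → ZMod 2) ℂ) s t = if s = t + x then 1 else 0 := rfl

theorem pauliZ_apply (z s t : Q → ZMod 2) :
    (pauliZ z : Matrix (Q → ZMod 2) (Q → ZMod 2) ℂ) s t = if s = t then signChar (z ⬝ᵥ s) else 0 :=
  rfl

/-- The unitary that permutes the computational basis. -/
def permUnitary (π : Equiv.Perm (Q → ZMod 2)) : QubitUnitary Q :=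
  ⟨Matrix.of fun s t => if s = π t then 1 else 0, by
    rw [Matrix.mem_unitaryGroup_iff]
    ext s t
    rw [Matrix.mul_apply, Finset.sum_eq_single (π.symm s)]
    · by_cases h : s = t
      · subst h; simp [Matrix.star_apply]
      · have h' : ¬ t = s := fun e => h e.symm
        simp [Matrix.star_apply, h, h']
    · intro b _ hb
      have h : ¬ s = π b := fun e => hb (by rw [e]; simp)
      simp [h]
    · simp⟩

theorem permUnitary_apply (π : Equiv.Perm (Q → ZMod 2)) (s t : Q → ZMod 2) :
    (permUnitary π : Matrix (Q → ZMod 2) (Q → ZMod 2) ℂ) s t = if s = π t then 1 else 0 := rfl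

theorem permUnitary_mul_apply (π : Equiv.Perm (Q → ZMod 2))
    (M : Matrix (Q → ZMod 2) (Q → ZMod 2) ℂ) (s t : Q → ZMod 2) :
    ((permUnitary π : Matrix (Q → ZMod 2) (Q → ZMod 2) ℂ) * M) s t = M (π.symm s) t := by
  rw [Matrix.mul_apply, Finset.sum_eq_single (π.symm s)]
  · simp [permUnitary_apply]
  · intro b _ hb
    have h : ¬ s = π b := fun e => hb (by rw [e]; simp)
    simp [permUnitary_apply, h]
  · simp

theorem mul_permUnitary_apply (π : Equiv.Perm (Q → ZMod 2))
    (M : Matrix (Q → ZMod 2) (Q → ZMod 2) ℂ) (s t : Q → ZMod 2) :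
    (M * (permUnitary π : Matrix (Q → ZMod 2) (Q → ZMod 2) ℂ)) s t = M s (π t) := by
  rw [Matrix.mul_apply, Finset.sum_eq_single (π t)]
  · simp [permUnitary_apply]
  · intro b _ hb
    simp [permUnitary_apply, hb]
  · simp

theorem permUnitary_mul (π σ : Equiv.Perm (Q → ZMod 2)) :
    permUnitary (π * σ) = permUnitary π * permUnitary σ := by
  ext s t
  rw [Submonoid.coe_mul, permUnitary_mul_apply, permUnitary_apply, permUnitary_apply]
  exact if_congr (by simp [Equiv.symm_apply_eq]) rfl rfl

theorem permUnitary_one : permUnitary (1 : Equiv.Perm (Q → ZMod 2)) = 1 := by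
  ext s t
  rw [permUnitary_apply, OneMemClass.coe_one, Matrix.one_apply]
  exact if_congr (by simp) rfl rfl

theorem permUnitary_list_prod (l : List (Equiv.Perm (Q → ZMod 2))) :
    permUnitary l.prod = (l.map permUnitary).prod := by
  induction l with
  | nil => simp [permUnitary_one]
  | cons a l ih => simp [permUnitary_mul, ih]

theorem pauliX_eq_permUnitary (x : Q → ZMod 2) : pauliX x = permUnitary (Equiv.addRight x) := by
  ext s t
  rw [pauliX_apply, permUnitary_apply]
  exact if_congr (by simp) rfl rfl

theorem pauliX_add (x y : Q → ZMod 2) : pauliX (x + y) = pauliX x * pauliX y := by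
  simp only [pauliX_eq_permUnitary, ← permUnitary_mul]
  congr 1
  ext s : 1
  simp only [Equiv.coe_addRight, Equiv.Perm.mul_apply]
  abel

theorem pauliX_zero : pauliX (0 : Q → ZMod 2) = 1 := by
  rw [pauliX_eq_permUnitary, ← permUnitary_one]
  congr 1
  ext s : 1
  simp

theorem pauliZ_add (x y : Q → ZMod 2) : pauliZ (x + y) = pauliZ x * pauliZ y := by
  ext s t
  change _ = (Matrix.diagonal _ * Matrix.diagonal _ : Matrix (Q → ZMod 2) (Q → ZMod 2) ℂ) s t
  rw [Matrix.diagonal_mul_diagonal, pauliZ_apply, Matrix.diagonal_apply]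
  simp only [add_dotProduct, signChar_add]
  rfl

theorem pauliZ_zero : pauliZ (0 : Q → ZMod 2) = 1 := by
  ext s t
  simp [pauliZ_apply, Matrix.one_apply, signChar_zero]

theorem pauliX_comm (x y : Q → ZMod 2) : pauliX x * pauliX y = pauliX y * pauliX x := by
  rw [← pauliX_add, add_comm, pauliX_add]

theorem pauliZ_comm (x y : Q → ZMod 2) : pauliZ x * pauliZ y = pauliZ y * pauliZ x := by
  rw [← pauliZ_add, add_comm, pauliZ_add]

/-- The commutation relation of `Z`- and `X`-operators. -/
theorem pauliZ_mul_pauliX (z x : Q → ZMod 2) :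
    (pauliZ z * pauliX x : Matrix (Q → ZMod 2) (Q → ZMod 2) ℂ) =
      signChar (z ⬝ᵥ x) • (pauliX x * pauliZ z : Matrix (Q → ZMod 2) (Q → ZMod 2) ℂ) := by
  ext s t
  rw [pauliX_eq_permUnitary, mul_permUnitary_apply, Matrix.smul_apply, permUnitary_mul_apply,
    pauliZ_apply, pauliZ_apply]
  by_cases h : s = (Equiv.addRight x) t
  · subst h
    simp [dotProduct_add, signChar_add, mul_comm]
  · have h' : ¬ (Equiv.addRight x).symm s = t := by rwa [Equiv.symm_apply_eq]
    rw [if_neg h, if_neg h', smul_zero]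

theorem coe_ne_zero (U : QubitUnitary Q) : (U : Matrix (Q → ZMod 2) (Q → ZMod 2) ℂ) ≠ 0 := by
  intro h
  have h1 := Matrix.mem_unitaryGroup_iff.1 U.2
  rw [h, zero_mul] at h1
  exact zero_ne_one h1

/-- A product of unitaries is nonzero and so differs from its negative. Commuting and anticommuting
therefore exclude each other, and the sign decides which one holds. -/
theorem eq_signChar_smul_iff {O S : QubitUnitary Q} {a : ZMod 2}
    (h : (O * S : Matrix (Q → ZMod 2) (Q → ZMod 2) ℂ) =
      signChar a • (S * O : Matrix (Q → ZMod 2) (Q → ZMod 2) ℂ)) :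
    (Violates O S ↔ a ≠ 0) ∧ (Commute O S ↔ a = 0) := by
  have hne : (S * O : Matrix (Q → ZMod 2) (Q → ZMod 2) ℂ) ≠ 0 := coe_ne_zero (S * O)
  have hne' : ¬ (S * O : Matrix (Q → ZMod 2) (Q → ZMod 2) ℂ) = - (S * O) := fun e => by
    refine hne ?_
    ext s t
    exact self_eq_neg.1 (congrFun (congrFun e s) t)
  have hc : Commute O S ↔ (O * S : Matrix (Q → ZMod 2) (Q → ZMod 2) ℂ) = S * O := by
    rw [commute_iff_eq, ← Subtype.coe_inj]; rfl
  rw [Violates, hc, h]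
  by_cases ha : a = 0
  · simp [ha, signChar_zero, hne']
  · have : ¬ -(S * O : Matrix (Q → ZMod 2) (Q → ZMod 2) ℂ) = (S * O) := fun e => hne' e.symm
    simp [ha, signChar, this]

theorem pauli_mul_pauliX (x z y : Q → ZMod 2) :
    (pauli x z * pauliX y : Matrix (Q → ZMod 2) (Q → ZMod 2) ℂ) =
      signChar (z ⬝ᵥ y) • (pauliX y * pauli x z : Matrix (Q → ZMod 2) (Q → ZMod 2) ℂ) := by
  have h : (pauliX x * pauliX y : Matrix (Q → ZMod 2) (Q → ZMod 2) ℂ) = pauliX y * pauliX x :=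
    congrArg Subtype.val (pauliX_comm x y)
  rw [pauli, Submonoid.coe_mul, mul_assoc, pauliZ_mul_pauliX, Matrix.mul_smul, ← mul_assoc, h,
    mul_assoc]

theorem pauli_mul_pauliZ (x z w : Q → ZMod 2) :
    (pauli x z * pauliZ w : Matrix (Q → ZMod 2) (Q → ZMod 2) ℂ) =
      signChar (w ⬝ᵥ x) • (pauliZ w * pauli x z : Matrix (Q → ZMod 2) (Q → ZMod 2) ℂ) := by
  have h : (pauliZ z * pauliZ w : Matrix (Q → ZMod 2) (Q → ZMod 2) ℂ) = pauliZ w * pauliZ z :=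
    congrArg Subtype.val (pauliZ_comm z w)
  rw [pauli, Submonoid.coe_mul, mul_assoc, h, ← mul_assoc, ← mul_assoc, pauliZ_mul_pauliX,
    smul_mul_assoc, smul_smul, ← signChar_add, CharTwo.add_self_eq_zero, signChar_zero, one_smul]

theorem violates_pauli_pauliX (x z y : Q → ZMod 2) :
    Violates (pauli x z) (pauliX y) ↔ z ⬝ᵥ y ≠ 0 :=
  (eq_signChar_smul_iff (pauli_mul_pauliX x z y)).1

theorem commute_pauli_pauliX (x z y : Q → ZMod 2) :
    Commute (pauli x z) (pauliX y) ↔ z ⬝ᵥ y = 0 :=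
  (eq_signChar_smul_iff (pauli_mul_pauliX x z y)).2

theorem violates_pauli_pauliZ (x z w : Q → ZMod 2) :
    Violates (pauli x z) (pauliZ w) ↔ w ⬝ᵥ x ≠ 0 :=
  (eq_signChar_smul_iff (pauli_mul_pauliZ x z w)).1

theorem pauli_zero_right (x : Q → ZMod 2) : pauli x 0 = pauliX x := by
  rw [pauli, pauliZ_zero, mul_one]

theorem violates_pauliX_pauliX (x y : Q → ZMod 2) : ¬ Violates (pauliX x) (pauliX y) := by
  rw [← pauli_zero_right, violates_pauli_pauliX]; simp

theorem violates_pauliX_pauliZ (x w : Q → ZMod 2) :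
    Violates (pauliX x) (pauliZ w) ↔ w ⬝ᵥ x ≠ 0 := by
  rw [← pauli_zero_right, violates_pauli_pauliZ]

/-- Double annihilator: a vector outside the span is separated from it by a linear functional, and
every functional is a dot product. This allows groups of `Z`-stabilizers to be compared through the
`X`-vectors that commute with them. -/
theorem mem_span_of_dotProduct {Z : Set (Q → ZMod 2)} {z : Q → ZMod 2}
    (h : ∀ x, (∀ w ∈ Z, w ⬝ᵥ x = 0) → z ⬝ᵥ x = 0) : z ∈ Submodule.span (ZMod 2) Z := by
  by_contra hz
  obtain ⟨f, hf, hle⟩ := Submodule.exists_le_ker_of_notMem hz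
  have hf' : ∀ w, w ⬝ᵥ (fun q => f (Pi.single q 1)) = f w := by
    intro w
    rw [LinearMap.pi_apply_eq_sum_univ f w]
    simp [dotProduct, ← Pi.single_apply, Pi.single_comm]
  refine hf ?_
  rw [← hf']
  refine h _ fun w hw => ?_
  rw [hf']
  exact hle (Submodule.subset_span hw)

/-! ### Stabilizer groups under conjugation -/

theorem CSSCode.stabilizerGroup_le {S : CSSCode Q} {H : Subgroup (QubitUnitary Q)}
    (hX : ∀ x ∈ S.xChecks, pauliX x ∈ H) (hZ : ∀ z ∈ S.zChecks, pauliZ z ∈ H) :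
    S.stabilizerGroup ≤ H := by
  rw [stabilizerGroup, Subgroup.closure_le]
  rintro _ (⟨x, hx, rfl⟩ | ⟨z, hz, rfl⟩)
  exacts [hX x hx, hZ z hz]

theorem CSSCode.pauliX_mem {S : CSSCode Q} {x : Q → ZMod 2}
    (hx : x ∈ Submodule.span (ZMod 2) S.xChecks) : pauliX x ∈ S.stabilizerGroup := by
  induction hx using Submodule.span_induction with
  | mem x hx => exact Subgroup.subset_closure (Or.inl ⟨x, hx, rfl⟩)
  | zero => rw [pauliX_zero]; exact one_mem _
  | add x y _ _ hx hy => rw [pauliX_add]; exact mul_mem hx hy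
  | smul a x _ hx =>
    rcases zmod_two_cases a with rfl | rfl
    · rw [zero_smul, pauliX_zero]; exact one_mem _
    · rwa [one_smul]

theorem CSSCode.pauliZ_mem {S : CSSCode Q} {x : Q → ZMod 2}
    (hx : x ∈ Submodule.span (ZMod 2) S.zChecks) : pauliZ x ∈ S.stabilizerGroup := by
  induction hx using Submodule.span_induction with
  | mem x hx => exact Subgroup.subset_closure (Or.inr ⟨x, hx, rfl⟩)
  | zero => rw [pauliZ_zero]; exact one_mem _
  | add x y _ _ hx hy => rw [pauliZ_add]; exact mul_mem hx hy
  | smul a x _ hx =>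
    rcases zmod_two_cases a with rfl | rfl
    · rw [zero_smul, pauliZ_zero]; exact one_mem _
    · rwa [one_smul]

/-- The unitary of a linear reversible circuit. -/
def linUnitary (L : (Q → ZMod 2) ≃ₗ[ZMod 2] (Q → ZMod 2)) : QubitUnitary Q :=
  permUnitary L.toEquiv

theorem linUnitary_mul_pauliX (L : (Q → ZMod 2) ≃ₗ[ZMod 2] (Q → ZMod 2)) (x : Q → ZMod 2) :
    linUnitary L * pauliX x = pauliX (L x) * linUnitary L := by
  rw [linUnitary, pauliX_eq_permUnitary, pauliX_eq_permUnitary, ← permUnitary_mul,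
    ← permUnitary_mul]
  congr 1
  ext s : 1
  simp

theorem linUnitary_mul_pauliZ (L : (Q → ZMod 2) ≃ₗ[ZMod 2] (Q → ZMod 2)) {z z' : Q → ZMod 2}
    (h : ∀ s, z' ⬝ᵥ L s = z ⬝ᵥ s) :
    linUnitary L * pauliZ z = pauliZ z' * linUnitary L := by
  ext s t
  rw [linUnitary, Submonoid.coe_mul, Submonoid.coe_mul, permUnitary_mul_apply,
    mul_permUnitary_apply, pauliZ_apply, pauliZ_apply]
  by_cases hs : s = L.toEquiv t
  · subst hs
    rw [if_pos rfl, if_pos (Equiv.symm_apply_apply _ _), Equiv.symm_apply_apply, ← h t]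
    rfl
  · have h' : ¬ L.toEquiv.symm s = t := by rwa [Equiv.symm_apply_eq]
    rw [if_neg hs, if_neg h']

theorem linUnitary_mul (L M : (Q → ZMod 2) ≃ₗ[ZMod 2] (Q → ZMod 2)) :
    linUnitary (L * M) = linUnitary L * linUnitary M :=
  permUnitary_mul L.toEquiv M.toEquiv

/-- `X`-vectors are moved by `L`, `Z`-vectors by its inverse transpose. Phrasing the condition on
`Z` through annihilators keeps the transpose out of all applications. -/
theorem map_conj_linUnitary_le (L : (Q → ZMod 2) ≃ₗ[ZMod 2] (Q → ZMod 2)) (S T : CSSCode Q)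
    (hX : ∀ x ∈ S.xChecks, L x ∈ Submodule.span (ZMod 2) T.xChecks)
    (hZ : ∀ x, (∀ z ∈ T.zChecks, z ⬝ᵥ L x = 0) → ∀ z ∈ S.zChecks, z ⬝ᵥ x = 0) :
    S.stabilizerGroup.map (MulAut.conj (linUnitary L)).toMonoidHom ≤ T.stabilizerGroup := by
  rw [Subgroup.map_le_iff_le_comap]
  refine CSSCode.stabilizerGroup_le (fun x hx => ?_) (fun z hz => ?_)
  · have : linUnitary L * pauliX x * (linUnitary L)⁻¹ = pauliX (L x) := by
      rw [linUnitary_mul_pauliX, mul_inv_cancel_right]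
    simpa [this] using CSSCode.pauliX_mem (hX x hx)
  · let z' : Q → ZMod 2 := fun q => z ⬝ᵥ L.symm (Pi.single q 1)
    have h : ∀ s, z' ⬝ᵥ s = z ⬝ᵥ L.symm s := by
      intro s
      conv_rhs => rw [← Finset.univ_sum_single s]
      rw [map_sum, dotProduct_sum, dotProduct]
      refine Finset.sum_congr rfl fun q _ => ?_
      have : (Pi.single q (s q) : Q → ZMod 2) = s q • Pi.single q 1 := by
        rw [← Pi.single_smul, smul_eq_mul, mul_one]
      rw [this, map_smul, dotProduct_smul, smul_eq_mul, mul_comm]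
    have h1 : linUnitary L * pauliZ z * (linUnitary L)⁻¹ = pauliZ z' := by
      rw [linUnitary_mul_pauliZ L (z' := z') (fun s => by rw [h, L.symm_apply_apply]),
        mul_inv_cancel_right]
    have h2 : z' ∈ Submodule.span (ZMod 2) T.zChecks := by
      refine mem_span_of_dotProduct fun x hx => ?_
      rw [h]
      exact hZ _ (by simpa using hx) z hz
    simpa [h1] using CSSCode.pauliZ_mem h2

theorem map_conj_linUnitary (L : (Q → ZMod 2) ≃ₗ[ZMod 2] (Q → ZMod 2)) (S T : CSSCode Q)
    (hX : ∀ x ∈ S.xChecks, L x ∈ Submodule.span (ZMod 2) T.xChecks)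
    (hX' : ∀ x ∈ T.xChecks, L.symm x ∈ Submodule.span (ZMod 2) S.xChecks)
    (hZ : ∀ x, (∀ z ∈ T.zChecks, z ⬝ᵥ L x = 0) ↔ ∀ z ∈ S.zChecks, z ⬝ᵥ x = 0) :
    S.stabilizerGroup.map (MulAut.conj (linUnitary L)).toMonoidHom = T.stabilizerGroup := by
  refine le_antisymm (map_conj_linUnitary_le L S T hX fun x => (hZ x).1) ?_
  have h := map_conj_linUnitary_le L.symm T S hX' fun x hx => by
    have := (hZ (L.symm x)).2 hx
    simpa using this
  have hinv : linUnitary L * linUnitary L.symm = 1 := by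
    rw [← linUnitary_mul, ← permUnitary_one]
    exact congrArg permUnitary (Equiv.ext fun s => by simp)
  have h2 := Subgroup.map_mono (f := (MulAut.conj (linUnitary L)).toMonoidHom) h
  rw [Subgroup.map_map] at h2
  convert h2
  have : (MulAut.conj (linUnitary L)).toMonoidHom.comp
      (MulAut.conj (linUnitary L.symm)).toMonoidHom = MonoidHom.id _ := by
    ext1 g
    have := congrArg (fun f => f g) (map_mul MulAut.conj (linUnitary L) (linUnitary L.symm))
    rw [hinv] at this
    simpa using this.symm
  rw [this, Subgroup.map_id]

/-! ### The Hadamard gate -/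

theorem star_pauliX (x : Q → ZMod 2) :
    star (pauliX x : Matrix (Q → ZMod 2) (Q → ZMod 2) ℂ) = pauliX x := by
  ext s t
  rw [Matrix.star_apply, pauliX_apply, pauliX_apply]
  have : t = s + x ↔ s = t + x := by
    constructor <;> (rintro rfl; rw [add_assoc, add_self_zmod_two, add_zero])
  simp [this]

theorem star_pauliZ (z : Q → ZMod 2) :
    star (pauliZ z : Matrix (Q → ZMod 2) (Q → ZMod 2) ℂ) = pauliZ z := by
  ext s t
  rw [Matrix.star_apply, pauliZ_apply, pauliZ_apply]
  by_cases h : s = t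
  · subst h
    by_cases h' : z ⬝ᵥ s = 0 <;> simp [signChar, h']
  · simp [h, Ne.symm h]

theorem pauliX_mul_self (x : Q → ZMod 2) :
    (pauliX x * pauliX x : Matrix (Q → ZMod 2) (Q → ZMod 2) ℂ) = 1 := by
  have := congrArg Subtype.val (pauliX_add x x)
  rw [add_self_zmod_two, pauliX_zero] at this
  exact this.symm

theorem pauliZ_mul_self (x : Q → ZMod 2) :
    (pauliZ x * pauliZ x : Matrix (Q → ZMod 2) (Q → ZMod 2) ℂ) = 1 := by
  have := congrArg Subtype.val (pauliZ_add x x)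
  rw [add_self_zmod_two, pauliZ_zero] at this
  exact this.symm

theorem invSqrtTwo_mul_self : (((√2 : ℝ)⁻¹ : ℝ) : ℂ) * (((√2 : ℝ)⁻¹ : ℝ) : ℂ) = 2⁻¹ := by
  rw [← Complex.ofReal_mul, ← mul_inv, Real.mul_self_sqrt (by norm_num)]
  simp

theorem pauliZ_mul_pauliX_single (q : Q) :
    (pauliZ (Pi.single q 1) * pauliX (Pi.single q 1) : Matrix (Q → ZMod 2) (Q → ZMod 2) ℂ) =
      - (pauliX (Pi.single q 1) * pauliZ (Pi.single q 1) :
        Matrix (Q → ZMod 2) (Q → ZMod 2) ℂ) := by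
  rw [pauliZ_mul_pauliX]
  simp [signChar]

/-- The Hadamard gate `(X + Z) / √2` on the qubit `q`. -/
noncomputable def hadamard (q : Q) : QubitUnitary Q :=
  ⟨(((√2 : ℝ)⁻¹ : ℝ) : ℂ) • ((pauliX (Pi.single q 1) : Matrix (Q → ZMod 2) (Q → ZMod 2) ℂ) +
    pauliZ (Pi.single q 1)), by
    rw [Matrix.mem_unitaryGroup_iff, star_smul, star_add, star_pauliX, star_pauliZ,
      smul_mul_smul_comm, add_mul, mul_add, mul_add, pauliX_mul_self, pauliZ_mul_self,
      pauliZ_mul_pauliX_single]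
    have : star (((√2 : ℝ)⁻¹ : ℝ) : ℂ) = (((√2 : ℝ)⁻¹ : ℝ) : ℂ) := Complex.conj_ofReal _
    rw [this, invSqrtTwo_mul_self, add_assoc, add_neg_cancel_left, ← two_smul ℂ, smul_smul]
    norm_num⟩

theorem coe_hadamard (q : Q) :
    (hadamard q : Matrix (Q → ZMod 2) (Q → ZMod 2) ℂ) =
      (((√2 : ℝ)⁻¹ : ℝ) : ℂ) • ((pauliX (Pi.single q 1) : Matrix (Q → ZMod 2) (Q → ZMod 2) ℂ) +
        pauliZ (Pi.single q 1)) := rfl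

theorem hadamard_commute_pauliX {q : Q} {x : Q → ZMod 2} (h : x q = 0) :
    Commute (hadamard q) (pauliX x) := by
  have h1 : (pauliX (Pi.single q 1) * pauliX x : Matrix (Q → ZMod 2) (Q → ZMod 2) ℂ) =
      pauliX x * pauliX (Pi.single q 1) := congrArg Subtype.val (pauliX_comm _ _)
  have h2 := pauliZ_mul_pauliX (Pi.single q 1) x
  rw [single_dotProduct, h, mul_zero, signChar_zero, one_smul] at h2
  refine Subtype.ext ?_
  rw [Submonoid.coe_mul, Submonoid.coe_mul, coe_hadamard, smul_mul_assoc, mul_smul_comm, add_mul,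
    mul_add, h1, h2]

theorem hadamard_commute_pauliZ {q : Q} {z : Q → ZMod 2} (h : z q = 0) :
    Commute (hadamard q) (pauliZ z) := by
  have h1 : (pauliZ (Pi.single q 1) * pauliZ z : Matrix (Q → ZMod 2) (Q → ZMod 2) ℂ) =
      pauliZ z * pauliZ (Pi.single q 1) := congrArg Subtype.val (pauliZ_comm _ _)
  have h2 := pauliZ_mul_pauliX z (Pi.single q 1)
  rw [dotProduct_single, h, zero_mul, signChar_zero, one_smul] at h2
  refine Subtype.ext ?_
  rw [Submonoid.coe_mul, Submonoid.coe_mul, coe_hadamard, smul_mul_assoc, mul_smul_comm, add_mul,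
    mul_add, h1, h2]

theorem hadamard_mul_pauliX_single (q : Q) :
    hadamard q * pauliX (Pi.single q 1) = pauliZ (Pi.single q 1) * hadamard q := by
  refine Subtype.ext ?_
  rw [Submonoid.coe_mul, Submonoid.coe_mul, coe_hadamard, smul_mul_assoc, mul_smul_comm, add_mul,
    mul_add, pauliX_mul_self, pauliZ_mul_self, add_comm]

/-- Hadamard gates on all qubits of a list. -/
noncomputable def hadamards (l : List Q) : QubitUnitary Q := (l.map hadamard).prod

theorem hadamards_commute {l : List Q} {O : QubitUnitary Q}
    (h : ∀ q ∈ l, Commute (hadamard q) O) : Commute (hadamards l) O := by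
  induction l with
  | nil => exact Commute.one_left _
  | cons a l ih =>
    rw [hadamards, List.map_cons, List.prod_cons]
    exact (h a (by simp)).mul_left (ih fun q hq => h q (by simp [hq]))

theorem hadamards_mul_pauliX_single {l : List Q} (hl : l.Nodup) {q : Q} (hq : q ∈ l) :
    hadamards l * pauliX (Pi.single q 1) = pauliZ (Pi.single q 1) * hadamards l := by
  induction l with
  | nil => simp at hq
  | cons a l ih =>
    rw [List.nodup_cons] at hl
    have hcons : hadamards (a :: l) = hadamard a * hadamards l := by
      rw [hadamards, List.map_cons, List.prod_cons]; rfl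
    rw [hcons]
    rcases List.mem_cons.1 hq with rfl | hq
    · have : Commute (hadamards l) (pauliX (Pi.single q 1)) :=
        hadamards_commute fun p hp => hadamard_commute_pauliX
          (Pi.single_eq_of_ne (fun e => hl.1 (by rwa [← e])) _)
      rw [mul_assoc, this.eq, ← mul_assoc, hadamard_mul_pauliX_single, mul_assoc]
    · have : Commute (hadamard a) (pauliZ (Pi.single q 1)) := hadamard_commute_pauliZ
          (Pi.single_eq_of_ne (fun e => hl.1 (by rwa [e])) _)
      rw [mul_assoc, ih hl.2 hq, ← mul_assoc, this.eq, mul_assoc]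

/-! ### Local layers -/

theorem supportedOn_of_entries {A : Set Q} {U : QubitUnitary Q}
    (h0 : ∀ s t, (U : Matrix (Q → ZMod 2) (Q → ZMod 2) ℂ) s t ≠ 0 → ∀ q, q ∉ A → s q = t q)
    (h1 : ∀ s t s' t', (∀ q, q ∉ A → s q = t q) → (∀ q, q ∉ A → s' q = t' q) →
      (∀ q ∈ A, s q = s' q) → (∀ q ∈ A, t q = t' q) →
      (U : Matrix (Q → ZMod 2) (Q → ZMod 2) ℂ) s t =
        (U : Matrix (Q → ZMod 2) (Q → ZMod 2) ℂ) s' t') : SupportedOn A U := by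
  classical
  -- The entries do not depend on the common values outside `A`, so the operator on `A` can be read
  -- off with zeros there.
  let ext (s : A → ZMod 2) : Q → ZMod 2 := fun q => if h : q ∈ A then s ⟨q, h⟩ else 0
  refine ⟨fun s t => (U : Matrix (Q → ZMod 2) (Q → ZMod 2) ℂ) (ext s) (ext t), ?_, ?_⟩
  · intro s t hst
    refine h1 _ _ _ _ hst ?_ ?_ ?_
    · intro q hq; simp [ext, hq]
    · intro q hq; simp [ext, hq]
    · intro q hq; simp [ext, hq]
  · intro s t hst
    by_contra h
    exact hst (h0 s t h)

theorem supportedOn_permUnitary {A : Set Q} {π : Equiv.Perm (Q → ZMod 2)}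
    (h0 : ∀ t, ∀ q, q ∉ A → π t q = t q)
    (h1 : ∀ t t', (∀ q ∈ A, t q = t' q) → ∀ q ∈ A, π t q = π t' q) :
    SupportedOn A (permUnitary π) := by
  have key : ∀ s t, (∀ q, q ∉ A → s q = t q) → (s = π t ↔ ∀ q ∈ A, s q = π t q) := by
    refine fun s t hst => ⟨fun h q _ => by rw [h], fun h => funext fun q => ?_⟩
    by_cases hq : q ∈ A
    · exact h q hq
    · rw [hst q hq, h0 t q hq]
  refine supportedOn_of_entries ?_ ?_
  · intro s t h q hq
    rw [permUnitary_apply] at h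
    have : s = π t := by by_contra h'; simp [h'] at h
    rw [this, h0 t q hq]
  · intro s t s' t' hst hst' hs ht
    rw [permUnitary_apply, permUnitary_apply]
    have : s = π t ↔ s' = π t' := by
      rw [key s t hst, key s' t' hst']
      refine forall₂_congr fun q hq => ?_
      rw [hs q hq, h1 t t' ht q hq]
    simp only [this]

theorem supportedOn_hadamard (q : Q) : SupportedOn {q} (hadamard q) := by
  have hX : ∀ s t : Q → ZMod 2, (∀ p, p ∉ ({q} : Set Q) → s p = t p) →
      (s = t + Pi.single q 1 ↔ s q = t q + 1) := by
    refine fun s t hst => ⟨fun h => by rw [h]; simp, fun h => funext fun p => ?_⟩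
    by_cases hp : p = q
    · subst hp; simp [h]
    · simp [hst p hp, hp]
  have hZ : ∀ s t : Q → ZMod 2, (∀ p, p ∉ ({q} : Set Q) → s p = t p) →
      (s = t ↔ s q = t q) := by
    refine fun s t hst => ⟨fun h => by rw [h], fun h => funext fun p => ?_⟩
    by_cases hp : p = q
    · rw [hp, h]
    · exact hst p hp
  refine supportedOn_of_entries ?_ ?_
  · intro s t h p hp
    rw [coe_hadamard, Matrix.smul_apply, Matrix.add_apply, pauliX_apply, pauliZ_apply] at h
    by_cases h1 : s = t + Pi.single q 1
    · rw [h1]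
      have : p ≠ q := hp
      simp [this]
    · by_cases h2 : s = t
      · rw [h2]
      · simp [h1, h2] at h
  · intro s t s' t' hst hst' hs ht
    rw [coe_hadamard, Matrix.smul_apply, Matrix.add_apply, pauliX_apply, pauliZ_apply,
      Matrix.smul_apply, Matrix.add_apply, pauliX_apply, pauliZ_apply]
    simp only [hX s t hst, hX s' t' hst', hZ s t hst, hZ s' t' hst', hs q rfl, ht q rfl,
      single_dotProduct]

section Layers

variable {W : Type*} {regions : Set (Set W)} {loc : Q → Set W}

theorem isLocalLayer_hadamards {l : List Q} (hl : l.Nodup)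
    (h : ∀ q ∈ l, ∃ R ∈ regions, loc q ⊆ R) : IsLocalLayer regions loc (hadamards l) := by
  refine ⟨l.map fun q => ({q}, hadamard q), ?_, ?_, ?_⟩
  · rw [List.map_map, List.pairwise_map]
    exact hl.imp fun h => by simpa using h
  · intro g hg
    obtain ⟨q, hq, rfl⟩ := List.mem_map.1 hg
    obtain ⟨R, hR, hq⟩ := h q hq
    exact ⟨supportedOn_hadamard q, R, hR, by simpa using hq⟩
  · rw [List.map_map]; rfl

/-- The part of the shear `s ↦ s + N s` on one block of the qubits. -/
def blockShear {ι : Type*} [DecidableEq ι] (blk : Q → ι) (N : (Q → ZMod 2) → (Q → ZMod 2))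
    (hN : ∀ s, N (s + N s) = N s)
    (hloc : ∀ s t q, (∀ p, blk p = blk q → s p = t p) → N s q = N t q) (i : ι) :
    Equiv.Perm (Q → ZMod 2) :=
  Function.Involutive.toPerm (fun s q => if blk q = i then s q + N s q else s q) (by
    intro s
    funext q
    by_cases hq : blk q = i
    · simp only [hq, if_true]
      -- Inside block `i` the modified vector agrees with the full shear `s + N s`, and `N` at `q`
      -- sees nothing else.
      have h := hloc (fun p => if blk p = i then s p + N s p else s p) (s + N s) q
        fun p hp => if_pos (hp.trans hq)
      rw [h, hN, add_assoc, CharTwo.add_self_eq_zero, add_zero]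
    · simp [hq])

theorem isLocalLayer_shear {ι : Type*} [Fintype ι] [DecidableEq ι] {blk : Q → ι}
    {region : ι → Set W} (hreg : ∀ i, region i ∈ regions) (hblk : ∀ q, loc q ⊆ region (blk q))
    (N : (Q → ZMod 2) → (Q → ZMod 2)) (hN : ∀ s, N (s + N s) = N s)
    (hloc : ∀ s t q, (∀ p, blk p = blk q → s p = t p) → N s q = N t q)
    {π : Equiv.Perm (Q → ZMod 2)} (hπ : ∀ s, π s = s + N s) :
    IsLocalLayer regions loc (permUnitary π) := by
  refine ⟨Finset.univ.toList.map fun i => ({q | blk q = i},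
    permUnitary (blockShear blk N hN hloc i)), ?_, ?_, ?_⟩
  · rw [List.map_map, List.pairwise_map]
    refine (Finset.nodup_toList Finset.univ).imp fun {i j} h => ?_
    exact Set.disjoint_left.2 fun q (hq : blk q = i) (hq' : blk q = j) => h (hq.symm.trans hq')
  · intro g hg
    obtain ⟨i, -, rfl⟩ := List.mem_map.1 hg
    refine ⟨supportedOn_permUnitary ?_ ?_, region i, hreg i, ?_⟩
    · intro t q hq
      exact if_neg hq
    · intro t t' ht q (hq : blk q = i)
      change (if blk q = i then t q + N t q else t q) = if blk q = i then t' q + N t' q else t' q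
      rw [if_pos hq, if_pos hq, ht q hq, hloc t t' q (fun p hp => ht p (hp.trans hq))]
    · intro q hq
      have : blk q = i := hq
      exact this ▸ hblk q
  -- The gates of distinct blocks do not interfere: each reads and writes its own block only, so
  -- their product is the shear on the union of the listed blocks.
  · have key : ∀ l : List ι, l.Nodup → ∀ s q, (l.map (blockShear blk N hN hloc)).prod s q =
        if blk q ∈ l then s q + N s q else s q := by
      intro l
      induction l with
      | nil => intro _ s q; simp
      | cons i l ih =>
        intro hl s q
        rw [List.nodup_cons] at hl
        rw [List.map_cons, List.prod_cons, Equiv.Perm.mul_apply]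
        generalize hs' : (l.map (blockShear blk N hN hloc)).prod s = s'
        change (if blk q = i then s' q + N s' q else s' q) = _
        by_cases hq : blk q = i
        · have h0 : ∀ p, blk p = blk q → s' p = s p := fun p hp => by
            rw [← hs', ih hl.2, if_neg]
            rw [hp, hq]; exact hl.1
          rw [if_pos hq, h0 q rfl, hloc s' s q h0, if_pos (by simp [hq])]
        · rw [if_neg hq, ← hs', ih hl.2]
          simp [hq]
    rw [List.map_map]
    have : π = (Finset.univ.toList.map (blockShear blk N hN hloc)).prod := by
      ext s : 1
      funext q
      rw [key _ (Finset.nodup_toList _), hπ]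
      simp
    rw [this, permUnitary_list_prod, List.map_map]
    rfl

end Layers

end PauliAlgebra

/-! ### Equivalence of codes by blockwise circuits -/

section BlockwiseEquivalence

theorem elim_dotProduct_elim {Q R : Type*} [Fintype Q] [Fintype R] (a x : Q → ZMod 2)
    (b y : R → ZMod 2) : Sum.elim a b ⬝ᵥ Sum.elim x y = a ⬝ᵥ x + b ⬝ᵥ y :=
  sumElim_dotProduct_sumElim ..

/-- An arbitrary left inverse may mix blocks. It is made local by evaluating it at `q` only after
the input has been set to zero outside the block of `q`. -/
theorem exists_blockwise_leftInverse {Q P ι : Type*} [Fintype Q] [Fintype P] [DecidableEq ι]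
    (bQ : Q → ι) (bP : P → ι) (Φ : (Q → ZMod 2) →ₗ[ZMod 2] (P → ZMod 2))
    (hΦ : ∀ x x' p, (∀ q, bQ q = bP p → x q = x' q) → Φ x p = Φ x' p)
    (hinj : ∀ x, Φ x = 0 → x = 0) :
    ∃ ψ : (P → ZMod 2) → (Q → ZMod 2), ψ 0 = 0 ∧ (∀ y y', ψ (y + y') = ψ y + ψ y') ∧
      (∀ (a : ZMod 2) y, ψ (a • y) = a • ψ y) ∧ (∀ x, ψ (Φ x) = x) ∧
      ∀ y y' q, (∀ p, bP p = bQ q → y p = y' p) → ψ y q = ψ y' q := by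
  obtain ⟨ψ₀, hψ₀⟩ := Φ.exists_leftInverse_of_injective (LinearMap.ker_eq_bot'.2 hinj)
  have hinv : ∀ x, ψ₀ (Φ x) = x := fun x => LinearMap.congr_fun hψ₀ x
  let cut (i : ι) (y : P → ZMod 2) : P → ZMod 2 := fun p => if bP p = i then y p else 0
  refine ⟨fun y q => ψ₀ (cut (bQ q) y) q, ?_, ?_, ?_, ?_, ?_⟩
  · funext q
    have : cut (bQ q) 0 = 0 := by funext p; simp [cut]
    simp [this]
  · intro y y'
    funext q
    have : cut (bQ q) (y + y') = cut (bQ q) y + cut (bQ q) y' := by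
      funext p
      by_cases h : bP p = bQ q <;> simp [cut, h]
    simp [this]
  · intro a y
    funext q
    have : cut (bQ q) (a • y) = a • cut (bQ q) y := by
      funext p
      by_cases h : bP p = bQ q <;> simp [cut, h]
    simp [this]
  · intro x
    funext q
    -- Since `Φ` respects the blocks, it commutes with cutting down to one block; thus the truncated
    -- input is still in the image of `Φ`.
    have : cut (bQ q) (Φ x) = Φ fun q' => if bQ q' = bQ q then x q' else 0 := by
      funext p
      by_cases h : bP p = bQ q
      · simp only [cut, h, if_true]
        exact hΦ _ _ _ fun q' hq' => by simp [hq', h]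
      · simp only [cut, h, if_false]
        have := hΦ (fun q' => if bQ q' = bQ q then x q' else 0) 0 p fun q' hq' => by
          simp [hq', h]
        rw [this]; simp
    simp only [this, hinv, if_true]
  · intro y y' q h
    have : cut (bQ q) y = cut (bQ q) y' := by
      funext p
      by_cases hp : bP p = bQ q
      · simp [cut, hp, h p hp]
      · simp [cut, hp]
    simp only [this]

/-- A linear map with `N (s + N s) = N s`, as the involution `s ↦ s + N s`. -/
def shearEquiv {Q : Type*} (N : (Q → ZMod 2) →ₗ[ZMod 2] (Q → ZMod 2))
    (hN : ∀ s, N (s + N s) = N s) : (Q → ZMod 2) ≃ₗ[ZMod 2] (Q → ZMod 2) :=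
  LinearEquiv.ofInvolutive (LinearMap.id + N) fun s => by
    simp only [LinearMap.add_apply, LinearMap.id_apply]
    rw [hN, add_assoc, add_self_zmod_two, add_zero]

/-- A code on the right summand, followed by ancillas: those of the first and third kind in the
states `|0⟩` and `|+⟩`. -/
def CSSCode.padded {R : Type*} (T : CSSCode R) (Q Δ : Type*) [DecidableEq Q] [DecidableEq Δ] :
    CSSCode (Q ⊕ (R ⊕ Δ)) where
  xChecks := (fun y => Sum.elim (0 : Q → ZMod 2) (Sum.elim y 0)) '' T.xChecks ∪
    Set.range fun d => Sum.elim (0 : Q → ZMod 2) (Sum.elim (0 : R → ZMod 2) (Pi.single d 1))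
  zChecks := (fun z => Sum.elim (0 : Q → ZMod 2) (Sum.elim z 0)) '' T.zChecks ∪
    Set.range fun q => Sum.elim (Pi.single q 1) 0

/-- Exchange of the first two kinds of qubits. -/
def exchange (Q R Δ : Type*) : Q ⊕ (R ⊕ Δ) ≃ R ⊕ (Q ⊕ Δ) where
  toFun := Sum.elim (fun q => .inr (.inl q)) (Sum.elim .inl fun d => .inr (.inr d))
  invFun := Sum.elim (fun r => .inr (.inl r)) (Sum.elim .inl fun d => .inr (.inr d))
  left_inv := by rintro (q | r | d) <;> rfl
  right_inv := by rintro (r | q | d) <;> rfl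

theorem single_inl {Q R : Type*} [DecidableEq Q] [DecidableEq R] (q : Q) :
    (Pi.single (Sum.inl q) 1 : Q ⊕ R → ZMod 2) = Sum.elim (Pi.single q 1) 0 := by
  funext p
  rcases p with p | p <;> simp [Pi.single_apply]

theorem single_inr {Q R : Type*} [DecidableEq Q] [DecidableEq R] (r : R) :
    (Pi.single (Sum.inr r) 1 : Q ⊕ R → ZMod 2) = Sum.elim (0 : Q → ZMod 2) (Pi.single r 1) := by
  funext p
  rcases p with p | p <;> simp [Pi.single_apply]

section

variable {Q R Δ : Type*} [Fintype Q] [DecidableEq Q] [Fintype R] [DecidableEq R] [Fintype Δ]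
  [DecidableEq Δ]

/-- Hadamard gates turn the `|+⟩` ancillas into `|0⟩` ancillas. -/
theorem map_conj_hadamards_padded (T : CSSCode R) {l : List (Q ⊕ (R ⊕ Δ))} (hl : l.Nodup)
    (hmem : ∀ p, p ∈ l ↔ ∃ d, p = .inr (.inr d)) :
    (T.padded Q Δ).stabilizerGroup.map (MulAut.conj (hadamards l)).toMonoidHom =
      ((T.tensor (CSSCode.ancilla (Q ⊕ Δ))).relabel (exchange Q R Δ)).stabilizerGroup := by
  set H := (T.padded Q Δ).stabilizerGroup.map (MulAut.conj (hadamards l)).toMonoidHom with hH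
  set G := ((T.tensor (CSSCode.ancilla (Q ⊕ Δ))).relabel (exchange Q R Δ)).stabilizerGroup
  have conj_comm : ∀ O : QubitUnitary (Q ⊕ (R ⊕ Δ)),
      (∀ p ∈ l, Commute (hadamard p) O) → (MulAut.conj (hadamards l)) O = O := by
    intro O hO
    rw [MulAut.conj_apply, (hadamards_commute hO).eq, mul_inv_cancel_right]
  have conj_x : ∀ x : Q ⊕ (R ⊕ Δ) → ZMod 2, (∀ d, x (.inr (.inr d)) = 0) →
      (MulAut.conj (hadamards l)) (pauliX x) = pauliX x := fun x hx => conj_comm _ fun p hp => by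
    obtain ⟨d, rfl⟩ := (hmem p).1 hp
    exact hadamard_commute_pauliX (hx d)
  have conj_z : ∀ x : Q ⊕ (R ⊕ Δ) → ZMod 2, (∀ d, x (.inr (.inr d)) = 0) →
      (MulAut.conj (hadamards l)) (pauliZ x) = pauliZ x := fun x hx => conj_comm _ fun p hp => by
    obtain ⟨d, rfl⟩ := (hmem p).1 hp
    exact hadamard_commute_pauliZ (hx d)
  have conj_s : ∀ d : Δ, (MulAut.conj (hadamards l))
      (pauliX (Sum.elim (0 : Q → ZMod 2) (Sum.elim (0 : R → ZMod 2) (Pi.single d 1)))) =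
      pauliZ (Sum.elim (0 : Q → ZMod 2) (Sum.elim (0 : R → ZMod 2) (Pi.single d 1))) := by
    intro d
    rw [← single_inr, ← single_inr, MulAut.conj_apply,
      hadamards_mul_pauliX_single hl ((hmem _).2 ⟨d, rfl⟩), mul_inv_cancel_right]
  have eX : ∀ y : R → ZMod 2, Sum.elim y (0 : Q ⊕ Δ → ZMod 2) ∘ exchange Q R Δ =
      Sum.elim (0 : Q → ZMod 2) (Sum.elim y 0) := by
    intro y; funext p; rcases p with q | r | d <;> rfl
  have eQ : ∀ q : Q, Sum.elim (0 : R → ZMod 2) (Pi.single (Sum.inl q : Q ⊕ Δ) 1) ∘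
      exchange Q R Δ = Sum.elim (Pi.single q 1) 0 := by
    intro q; rw [single_inl]; funext p; rcases p with q | r | d <;> rfl
  have eD : ∀ d : Δ, Sum.elim (0 : R → ZMod 2) (Pi.single (Sum.inr d : Q ⊕ Δ) 1) ∘
      exchange Q R Δ = Sum.elim (0 : Q → ZMod 2) (Sum.elim (0 : R → ZMod 2) (Pi.single d 1)) := by
    intro d; rw [single_inr]; funext p; rcases p with q | r | d <;> rfl
  apply le_antisymm
  · rw [hH, Subgroup.map_le_iff_le_comap]
    refine CSSCode.stabilizerGroup_le ?_ ?_
    · rintro _ (⟨y, hy, rfl⟩ | ⟨d, rfl⟩)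
      · change (MulAut.conj (hadamards l)) _ ∈ G
        rw [conj_x _ fun d => rfl]
        refine CSSCode.pauliX_mem (Submodule.subset_span ⟨_, Or.inl ⟨y, hy, rfl⟩, eX y⟩)
      · change (MulAut.conj (hadamards l)) _ ∈ G
        rw [conj_s]
        refine CSSCode.pauliZ_mem (Submodule.subset_span ⟨_, Or.inr ⟨_, ⟨_, rfl⟩, rfl⟩, eD d⟩)
    · rintro _ (⟨y, hy, rfl⟩ | ⟨q, rfl⟩)
      · change (MulAut.conj (hadamards l)) _ ∈ G
        rw [conj_z _ fun d => rfl]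
        refine CSSCode.pauliZ_mem (Submodule.subset_span ⟨_, Or.inl ⟨y, hy, rfl⟩, eX y⟩)
      · change (MulAut.conj (hadamards l)) _ ∈ G
        rw [conj_z _ fun d => rfl]
        refine CSSCode.pauliZ_mem (Submodule.subset_span ⟨_, Or.inr ⟨_, ⟨_, rfl⟩, rfl⟩, eQ q⟩)
  · refine CSSCode.stabilizerGroup_le ?_ ?_
    · rintro _ ⟨_, ⟨y, hy, rfl⟩ | ⟨_, h, -⟩, rfl⟩
      · refine ⟨_, CSSCode.pauliX_mem (Submodule.subset_span (Or.inl ⟨y, hy, rfl⟩)), ?_⟩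
        change (MulAut.conj (hadamards l)) _ = _
        rw [conj_x _ fun d => rfl]
        exact congrArg pauliX (eX y).symm
      · exact h.elim
    · rintro _ ⟨_, ⟨y, hy, rfl⟩ | ⟨_, ⟨q | d, rfl⟩, rfl⟩, rfl⟩
      · refine ⟨_, CSSCode.pauliZ_mem (Submodule.subset_span (Or.inl ⟨y, hy, rfl⟩)), ?_⟩
        change (MulAut.conj (hadamards l)) _ = _
        rw [conj_z _ fun d => rfl]
        exact congrArg pauliZ (eX y).symm
      · refine ⟨_, CSSCode.pauliZ_mem (Submodule.subset_span (Or.inr ⟨q, rfl⟩)), ?_⟩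
        change (MulAut.conj (hadamards l)) _ = _
        rw [conj_z _ fun d => rfl]
        exact congrArg pauliZ (eQ q).symm
      · refine ⟨_, CSSCode.pauliX_mem (Submodule.subset_span (Or.inr ⟨d, rfl⟩)), ?_⟩
        change (MulAut.conj (hadamards l)) _ = _
        rw [conj_s]
        exact congrArg pauliZ (eD d).symm

/-- The ancilla checks force the annihilator on the left to consist of vectors `(x, 0)`, on which
`L` is known. On the right the `Δ`-component is free, and `hΔ` reaches all of its values through
stabilizers invisible to `δ`; the `R`-component lies in the image of `δ` by `hT`. -/
theorem map_conj_linUnitary_padded (S : CSSCode Q) (T : CSSCode R)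
    (δ : (Q → ZMod 2) →ₗ[ZMod 2] (R → ZMod 2)) (ℓ : (Q → ZMod 2) →ₗ[ZMod 2] (Δ → ZMod 2))
    (hΔ : ∀ w, ∃ x ∈ Submodule.span (ZMod 2) S.xChecks, δ x = 0 ∧ ℓ x = w)
    (hXT : ∀ y ∈ T.xChecks, ∃ x ∈ Submodule.span (ZMod 2) S.xChecks, δ x = y)
    (hXS : ∀ x ∈ S.xChecks, δ x ∈ Submodule.span (ZMod 2) T.xChecks)
    (hZ : ∀ x, (∀ z ∈ T.zChecks, z ⬝ᵥ δ x = 0) ↔ ∀ z ∈ S.zChecks, z ⬝ᵥ x = 0)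
    (hT : ∀ y, (∀ z ∈ T.zChecks, z ⬝ᵥ y = 0) → ∃ x, δ x = y)
    (L : (Q ⊕ (R ⊕ Δ) → ZMod 2) ≃ₗ[ZMod 2] (Q ⊕ (R ⊕ Δ) → ZMod 2))
    (hL : ∀ x, L (Sum.elim x 0) = Sum.elim (0 : Q → ZMod 2) (Sum.elim (δ x) (ℓ x))) :
    (S.tensor (CSSCode.ancilla (R ⊕ Δ))).stabilizerGroup.map
      (MulAut.conj (linUnitary L)).toMonoidHom = (T.padded Q Δ).stabilizerGroup := by
  have hLs : ∀ x, L.symm (Sum.elim (0 : Q → ZMod 2) (Sum.elim (δ x) (ℓ x))) = Sum.elim x 0 := fun x => by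
    rw [← hL, L.symm_apply_apply]
  have adjust : ∀ x w, ∃ x' ∈ Submodule.span (ZMod 2) S.xChecks, δ (x + x') = δ x ∧
      ℓ (x + x') = w := by
    intro x w
    obtain ⟨x', h, h1, h2⟩ := hΔ (w + ℓ x)
    refine ⟨x', h, by rw [map_add, h1, add_zero], ?_⟩
    rw [map_add, h2, add_left_comm, add_self_zmod_two, add_zero]
  have hspan : ∀ x ∈ Submodule.span (ZMod 2) S.xChecks, (Sum.elim x 0 : Q ⊕ (R ⊕ Δ) → ZMod 2) ∈
      Submodule.span (ZMod 2) (S.tensor (CSSCode.ancilla (R ⊕ Δ))).xChecks := by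
    intro x hx
    let f : (Q → ZMod 2) →ₗ[ZMod 2] (Q ⊕ (R ⊕ Δ) → ZMod 2) :=
      { toFun := fun x => Sum.elim x 0
        map_add' := fun x y => by funext p; rcases p with p | p <;> simp
        map_smul' := fun x y => by funext p; rcases p with p | p <;> simp }
    have := Submodule.mem_map_of_mem (f := f) hx
    rw [Submodule.map_span] at this
    exact Submodule.span_mono (fun _ h => Or.inl h) this
  have hspanR : ∀ y ∈ Submodule.span (ZMod 2) T.xChecks,
      (Sum.elim (0 : Q → ZMod 2) (Sum.elim y 0) : Q ⊕ (R ⊕ Δ) → ZMod 2) ∈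
      Submodule.span (ZMod 2) (T.padded Q Δ).xChecks := by
    intro y hy
    let f : (R → ZMod 2) →ₗ[ZMod 2] (Q ⊕ (R ⊕ Δ) → ZMod 2) :=
      { toFun := fun y => Sum.elim (0 : Q → ZMod 2) (Sum.elim y 0)
        map_add' := fun x y => by funext p; rcases p with p | p | p <;> simp
        map_smul' := fun x y => by funext p; rcases p with p | p | p <;> simp }
    have := Submodule.mem_map_of_mem (f := f) hy
    rw [Submodule.map_span] at this
    exact Submodule.span_mono (fun _ h => Or.inl h) this
  have hspanΔ : ∀ w : Δ → ZMod 2, (Sum.elim (0 : Q → ZMod 2) (Sum.elim (0 : R → ZMod 2) w) : Q ⊕ (R ⊕ Δ) → ZMod 2) ∈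
      Submodule.span (ZMod 2) (T.padded Q Δ).xChecks := by
    intro w
    have : (Sum.elim (0 : Q → ZMod 2) (Sum.elim (0 : R → ZMod 2) w) : Q ⊕ (R ⊕ Δ) → ZMod 2) =
        ∑ d, w d • Sum.elim (0 : Q → ZMod 2) (Sum.elim (0 : R → ZMod 2) (Pi.single d 1)) := by
      funext p
      rw [Finset.sum_apply]
      rcases p with p | p | p <;> simp [Pi.single_apply]
    rw [this]
    exact Submodule.sum_mem _ fun d _ => Submodule.smul_mem _ _
      (Submodule.subset_span (Or.inr ⟨d, rfl⟩))
  refine map_conj_linUnitary L _ _ ?_ ?_ ?_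
  · rintro _ (⟨x, hx, rfl⟩ | ⟨_, h, -⟩)
    · change L (Sum.elim x 0) ∈ _
      rw [hL]
      have : (Sum.elim (0 : Q → ZMod 2) (Sum.elim (δ x) (ℓ x)) : Q ⊕ (R ⊕ Δ) → ZMod 2) =
          Sum.elim (0 : Q → ZMod 2) (Sum.elim (δ x) 0) + Sum.elim (0 : Q → ZMod 2) (Sum.elim (0 : R → ZMod 2) (ℓ x)) := by
        funext p; rcases p with p | p | p <;> simp
      rw [this]
      exact add_mem (hspanR _ (hXS x hx)) (hspanΔ _)
    · exact h.elim
  · have key : ∀ x ∈ Submodule.span (ZMod 2) S.xChecks, ∀ w,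
        L.symm (Sum.elim (0 : Q → ZMod 2) (Sum.elim (δ x) w)) ∈
          Submodule.span (ZMod 2) (S.tensor (CSSCode.ancilla (R ⊕ Δ))).xChecks := by
      intro x hx w
      obtain ⟨x', hx', h1, h2⟩ := adjust x w
      rw [← h1, ← h2, hLs]
      exact hspan _ (add_mem hx hx')
    rintro _ (⟨y, hy, rfl⟩ | ⟨d, rfl⟩)
    · obtain ⟨x, hx, rfl⟩ := hXT y hy
      exact key x hx 0
    · have := key 0 (zero_mem _) (Pi.single d 1)
      rwa [map_zero] at this
  · intro s
    constructor
    · intro h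
      set t := L s with ht
      have ht1 : ∀ q, t (.inl q) = 0 := fun q => by
        have := h (Sum.elim (Pi.single q 1) 0) (Or.inr ⟨q, rfl⟩)
        rw [← single_inl, single_dotProduct, one_mul] at this
        exact this
      have ht2 : ∀ z ∈ T.zChecks, z ⬝ᵥ (fun r => t (.inr (.inl r))) = 0 := fun z hz => by
        have := h _ (Or.inl ⟨z, hz, rfl⟩)
        rw [dotProduct, Fintype.sum_sum_type, Fintype.sum_sum_type] at this
        simpa [dotProduct] using this
      -- A preimage of the `R`-component is corrected by an element of the kernel of `δ` to give the
      -- prescribed `Δ`-component as well.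
      obtain ⟨x₀, hx₀⟩ := hT _ ht2
      obtain ⟨x', -, h1, h2⟩ := adjust x₀ fun d => t (.inr (.inr d))
      have hs : s = Sum.elim (x₀ + x') 0 := by
        rw [← hLs, LinearEquiv.eq_symm_apply, ← ht, h1, h2, hx₀]
        funext p
        rcases p with q | r | d
        · exact ht1 q
        · rfl
        · rfl
      have hx : ∀ z ∈ S.zChecks, z ⬝ᵥ (x₀ + x') = 0 := (hZ _).1 (by rwa [h1, hx₀])
      rintro _ (⟨z, hz, rfl⟩ | ⟨_, ⟨a, rfl⟩, rfl⟩)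
      · rw [hs, elim_dotProduct_elim, hx z hz, zero_dotProduct, add_zero]
      · rw [hs, elim_dotProduct_elim, zero_dotProduct, dotProduct_zero, add_zero]
    · intro h
      have hs : s = Sum.elim (fun q => s (.inl q)) 0 := by
        funext p
        rcases p with q | a
        · rfl
        · have := h (Sum.elim 0 (Pi.single a 1)) (Or.inr ⟨_, ⟨a, rfl⟩, rfl⟩)
          rw [← single_inr, single_dotProduct, one_mul] at this
          exact this
      have hx : ∀ z ∈ S.zChecks, z ⬝ᵥ (fun q => s (.inl q)) = 0 := fun z hz => by
        have := h _ (Or.inl ⟨z, hz, rfl⟩)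
        rw [hs] at this
        simpa [elim_dotProduct_elim] using this
      rw [hs, hL]
      rintro _ (⟨z, hz, rfl⟩ | ⟨q, rfl⟩)
      · rw [elim_dotProduct_elim, elim_dotProduct_elim, (hZ _).2 hx z hz]; simp
      · rw [elim_dotProduct_elim]; simp

end

/-- A linear map that is injective up to ancillas, works within the blocks of a partition of the
qubits into local regions, and matches the checks of two codes makes them locally equivalent. -/
theorem locallyEquivalent_of_blockwise {W ι : Type*} [Fintype ι] [DecidableEq ι]
    {regions : Set (Set W)} {Q R Δ : Type u} [Fintype Q] [DecidableEq Q] [Fintype R]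
    [DecidableEq R] [Fintype Δ] [DecidableEq Δ] (locQ : Q → Set W) (S : CSSCode Q)
    (locR : R → Set W) (T : CSSCode R) (bQ : Q → ι) (bR : R → ι) (bΔ : Δ → ι)
    (region : ι → Set W) (hreg : ∀ i, region i ∈ regions)
    (hQ : ∀ q, locQ q ⊆ region (bQ q)) (hR : ∀ r, locR r ⊆ region (bR r))
    (posQ : Q → W) (hposQ : ∀ q, posQ q ∈ region (bQ q))
    (posR : R → W) (hposR : ∀ r, posR r ∈ region (bR r))
    (posΔ : Δ → W) (hposΔ : ∀ d, posΔ d ∈ region (bΔ d))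
    (δ : (Q → ZMod 2) →ₗ[ZMod 2] (R → ZMod 2)) (ℓ : (Q → ZMod 2) →ₗ[ZMod 2] (Δ → ZMod 2))
    (hδ : ∀ x x' r, (∀ q, bQ q = bR r → x q = x' q) → δ x r = δ x' r)
    (hℓ : ∀ x x' d, (∀ q, bQ q = bΔ d → x q = x' q) → ℓ x d = ℓ x' d)
    (hinj : ∀ x, δ x = 0 → ℓ x = 0 → x = 0)
    (hΔ : ∀ w, ∃ x ∈ Submodule.span (ZMod 2) S.xChecks, δ x = 0 ∧ ℓ x = w)
    (hXT : ∀ y ∈ T.xChecks, ∃ x ∈ Submodule.span (ZMod 2) S.xChecks, δ x = y)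
    (hXS : ∀ x ∈ S.xChecks, δ x ∈ Submodule.span (ZMod 2) T.xChecks)
    (hZ : ∀ x, (∀ z ∈ T.zChecks, z ⬝ᵥ δ x = 0) ↔ ∀ z ∈ S.zChecks, z ⬝ᵥ x = 0)
    (hT : ∀ y, (∀ z ∈ T.zChecks, z ⬝ᵥ y = 0) → ∃ x, δ x = y) :
    LocallyEquivalent regions 3 locQ S locR T := by
  let Φ : (Q → ZMod 2) →ₗ[ZMod 2] (R ⊕ Δ → ZMod 2) :=
    { toFun := fun x => Sum.elim (δ x) (ℓ x)
      map_add' := fun x y => by funext p; rcases p with p | p <;> simp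
      map_smul' := fun a x => by funext p; rcases p with p | p <;> simp }
  have hΦ : ∀ x x' p, (∀ q, bQ q = Sum.elim bR bΔ p → x q = x' q) → Φ x p = Φ x' p := by
    rintro x x' (r | d) h
    · exact hδ x x' r h
    · exact hℓ x x' d h
  obtain ⟨ψ, hψ0, hψadd, hψsmul, hψ, hψloc⟩ := exists_blockwise_leftInverse bQ (Sum.elim bR bΔ) Φ hΦ
    fun x hx => hinj x (funext fun r => congrFun hx (.inl r)) (funext fun d => congrFun hx (.inr d))
  -- The two shears send `(x, 0)` to `(x, Φ x)` and then to `(x + ψ (Φ x), Φ x) = (0, Φ x)`. Each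
  -- one leaves unchanged the register that it reads, so it is an involution.
  let N₁ : (Q ⊕ (R ⊕ Δ) → ZMod 2) →ₗ[ZMod 2] (Q ⊕ (R ⊕ Δ) → ZMod 2) :=
    { toFun := fun s => Sum.elim 0 (Φ fun q => s (.inl q))
      map_add' := fun x y => by
        have : (fun q : Q => (x + y) (.inl q)) = (fun q => x (.inl q)) + fun q => y (.inl q) := rfl
        rw [this, map_add]
        funext p; rcases p with p | p <;> simp
      map_smul' := fun a x => by
        have : (fun q : Q => (a • x) (.inl q)) = a • (fun q => x (.inl q)) := rfl
        rw [this, map_smul]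
        funext p; rcases p with p | p <;> simp }
  let N₂ : (Q ⊕ (R ⊕ Δ) → ZMod 2) →ₗ[ZMod 2] (Q ⊕ (R ⊕ Δ) → ZMod 2) :=
    { toFun := fun s => Sum.elim (ψ fun p => s (.inr p)) 0
      map_add' := fun x y => by
        have : (fun q : R ⊕ Δ => (x + y) (.inr q)) =
          (fun q => x (.inr q)) + fun q => y (.inr q) := rfl
        rw [this, hψadd]
        funext p; rcases p with p | p <;> simp
      map_smul' := fun a x => by
        have : (fun q : R ⊕ Δ => (a • x) (.inr q)) = a • (fun q => x (.inr q)) := rfl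
        rw [this, hψsmul]
        funext p; rcases p with p | p <;> simp }
  have hN₁ : ∀ s, N₁ (s + N₁ s) = N₁ s := fun s => by
    change Sum.elim _ (Φ _) = Sum.elim _ (Φ _)
    congr 2
    funext q
    exact add_zero (s (.inl q))
  have hN₂ : ∀ s, N₂ (s + N₂ s) = N₂ s := fun s => by
    change Sum.elim (ψ _) _ = Sum.elim (ψ _) _
    congr 2
    funext q
    exact add_zero (s (.inr q))
  let L₁ := shearEquiv N₁ hN₁
  let L₂ := shearEquiv N₂ hN₂
  let blk : Q ⊕ (R ⊕ Δ) → ι := Sum.elim bQ (Sum.elim bR bΔ)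
  let posA : R ⊕ Δ → W := Sum.elim posR posΔ
  have hblk : ∀ p, (Sum.elim locQ fun a => {posA a}) p ⊆ region (blk p) := by
    rintro (q | r | d)
    · exact hQ q
    · exact Set.singleton_subset_iff.2 (hposR r)
    · exact Set.singleton_subset_iff.2 (hposΔ d)
  let l : List (Q ⊕ (R ⊕ Δ)) := (Finset.univ : Finset Δ).toList.map fun d => .inr (.inr d)
  have hl : l.Nodup := (Finset.nodup_toList _).map fun a b h => by simpa using h
  have hmem : ∀ p, p ∈ l ↔ ∃ d, p = .inr (.inr d) := fun p => by simp [l, eq_comm]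
  refine ⟨R ⊕ Δ, Q ⊕ Δ, inferInstance, inferInstance, inferInstance, inferInstance, posA,
    Sum.elim posQ posΔ, exchange Q R Δ, hadamards l * linUnitary (L₂ * L₁), ?_, ?_, ?_⟩
  · intro p
    refine ⟨region (blk p), hreg _, hblk p, ?_⟩
    rcases p with q | r | d
    · exact Set.singleton_subset_iff.2 (hposQ q)
    · exact hR r
    · exact Set.singleton_subset_iff.2 (hposΔ d)
  · refine ⟨[hadamards l, linUnitary L₂, linUnitary L₁], by simp, ?_, by
      simp [linUnitary_mul]⟩
    intro V hV
    simp only [List.mem_cons, List.not_mem_nil, or_false] at hV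
    rcases hV with rfl | rfl | rfl
    · exact isLocalLayer_hadamards hl fun p _ => ⟨_, hreg _, hblk p⟩
    · refine isLocalLayer_shear hreg hblk N₂ hN₂ ?_ fun s => rfl
      rintro s t (q | p) h
      · exact hψloc _ _ _ fun p hp => h (.inr p) hp
      · rfl
    · refine isLocalLayer_shear hreg hblk N₁ hN₁ ?_ fun s => rfl
      rintro s t (q | p) h
      · rfl
      · exact hΦ _ _ _ fun q hq => h (.inl q) hq
  · have hL : ∀ x, (L₂ * L₁) (Sum.elim x 0) = Sum.elim (0 : Q → ZMod 2) (Sum.elim (δ x) (ℓ x)) := by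
      intro x
      change L₂ (Sum.elim x 0 + N₁ (Sum.elim x 0)) = _
      have h1 : Sum.elim x 0 + N₁ (Sum.elim x 0) = Sum.elim x (Φ x) := by
        funext p
        rcases p with p | p
        · exact add_zero _
        · exact zero_add _
      rw [h1]
      change Sum.elim x (Φ x) + Sum.elim (ψ (Φ x)) 0 = _
      rw [hψ]
      funext p
      rcases p with p | p
      · exact CharTwo.add_self_eq_zero _
      · exact add_zero _
    rw [← map_conj_hadamards_padded T hl hmem,
      ← map_conj_linUnitary_padded S T δ ℓ hΔ hXT hXS hZ hT _ hL, Subgroup.map_map, map_mul]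
    rfl

end BlockwiseEquivalence

/-! ### Residues of colored graphs -/

namespace ColoredGraph

variable {G : ColoredGraph.{u}}

theorem mem_residue_self (S : Finset Color) (v : G.Vertex) : v ∈ G.residue S v :=
  Relation.ReflTransGen.refl

theorem nbr_mem_residue {S : Finset Color} {c : Color} (hc : c ∈ S) {v w : G.Vertex}
    (h : w ∈ G.residue S v) : G.nbr c w ∈ G.residue S v :=
  Relation.ReflTransGen.tail h ⟨c, hc, rfl⟩

theorem residue_subset {S : Finset Color} {A : Set G.Vertex} {v : G.Vertex} (hv : v ∈ A)
    (hA : ∀ c ∈ S, ∀ w ∈ A, G.nbr c w ∈ A) : G.residue S v ⊆ A := by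
  intro w hw
  induction hw with
  | refl => exact hv
  | tail _ h ih => obtain ⟨c, hc, rfl⟩ := h; exact hA c hc _ ih

theorem mem_residue_symm {S : Finset Color} {v w : G.Vertex} (h : w ∈ G.residue S v) :
    v ∈ G.residue S w := by
  induction h with
  | refl => exact mem_residue_self S v
  | tail _ h ih =>
    obtain ⟨c, hc, rfl⟩ := h
    refine Relation.ReflTransGen.head ⟨c, hc, ?_⟩ ih
    rw [G.nbr_nbr]

theorem residue_eq {S : Finset Color} {v w : G.Vertex} (h : w ∈ G.residue S v) :
    G.residue S w = G.residue S v :=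
  Set.Subset.antisymm (fun _ hu => Relation.ReflTransGen.trans h hu)
    fun _ hu => Relation.ReflTransGen.trans (mem_residue_symm h) hu

theorem residue_nbr {S : Finset Color} {c : Color} (hc : c ∈ S) (v : G.Vertex) :
    G.residue S (G.nbr c v) = G.residue S v :=
  residue_eq (nbr_mem_residue hc (mem_residue_self S v))

theorem residue_mono {S T : Finset Color} (h : S ⊆ T) (v : G.Vertex) :
    G.residue S v ⊆ G.residue T v :=
  residue_subset (mem_residue_self T v) fun _ hc _ hw => nbr_mem_residue (h hc) hw

theorem eq_of_mem_residue {α : Type*} {S : Finset Color} {f : G.Vertex → α}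
    (hf : ∀ c ∈ S, ∀ v, f (G.nbr c v) = f v) {v w : G.Vertex} (h : w ∈ G.residue S v) :
    f w = f v :=
  residue_subset (A := {w | f w = f v}) rfl (fun c hc w (hw : f w = f v) => (hf c hc w).trans hw) h

/-- The piece that contains a vertex. -/
def toResidue (S : Finset Color) (v : G.Vertex) : G.Residue S := ⟨G.residue S v, v, rfl⟩

theorem mem_iff_toResidue_eq {S : Finset Color} {B : G.Residue S} {v : G.Vertex} :
    v ∈ B.1 ↔ toResidue S v = B := by
  obtain ⟨_, w, rfl⟩ := B
  refine ⟨fun h => Subtype.ext (residue_eq h), fun h => ?_⟩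
  have : G.residue S v = G.residue S w := congrArg Subtype.val h
  change v ∈ G.residue S w
  rw [← this]
  exact mem_residue_self S v

theorem mem_toResidue (S : Finset Color) (v : G.Vertex) : v ∈ (toResidue S v).1 :=
  mem_residue_self S v

theorem exists_eq_toResidue {S : Finset Color} (B : G.Residue S) : ∃ v, B = toResidue S v := by
  obtain ⟨_, v, rfl⟩ := B
  exact ⟨v, rfl⟩

theorem toResidue_nbr {S : Finset Color} {c : Color} (hc : c ∈ S) (v : G.Vertex) :
    toResidue S (G.nbr c v) = toResidue S v :=
  Subtype.ext (residue_nbr hc v)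

theorem residue_subset_iff {S T : Finset Color} (h : S ⊆ T) {v : G.Vertex} {C : G.Residue T} :
    G.residue S v ⊆ C.1 ↔ toResidue T v = C := by
  rw [← mem_iff_toResidue_eq]
  refine ⟨fun hv => hv (mem_residue_self S v), fun hv => ?_⟩
  obtain ⟨w, rfl⟩ := exists_eq_toResidue C
  exact residue_subset hv fun _ hc _ hw => nbr_mem_residue (h hc) hw

theorem residue_singleton (c : Color) (v : G.Vertex) :
    G.residue {c} v = {v, G.nbr c v} := by
  refine Set.Subset.antisymm (residue_subset (by simp) ?_) ?_
  · intro c' hc' w hw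
    rw [Finset.mem_singleton] at hc'
    subst hc'
    rcases hw with rfl | rfl
    · simp
    · simp [G.nbr_nbr]
  · rintro w (rfl | rfl)
    · exact mem_residue_self _ _
    · exact nbr_mem_residue (by simp) (mem_residue_self _ _)

open Classical in
/-- Summation over vertices, piece by piece. -/
theorem sum_residue {M : Type*} [AddCommMonoid M] (S : Finset Color) (p : G.Residue S → Prop)
    (f : G.Vertex → M) :
    ∑ B : G.Residue S, (if p B then ∑ v, if v ∈ B.1 then f v else 0 else 0) =
      ∑ v, if p (toResidue S v) then f v else 0 := by
  have : ∀ B : G.Residue S, (if p B then ∑ v, if v ∈ B.1 then f v else 0 else 0) =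
      ∑ v, if toResidue S v = B then (if p (toResidue S v) then f v else 0) else 0 := by
    intro B
    by_cases hp : p B
    · rw [if_pos hp]
      refine Finset.sum_congr rfl fun v _ => ?_
      by_cases h : toResidue S v = B
      · rw [if_pos (mem_iff_toResidue_eq.2 h), if_pos h, if_pos (h ▸ hp)]
      · rw [if_neg (mt mem_iff_toResidue_eq.1 h), if_neg h]
    · rw [if_neg hp]
      refine (Finset.sum_eq_zero fun v _ => ?_).symm
      by_cases h : toResidue S v = B
      · rw [if_pos h, if_neg (h ▸ hp)]
      · rw [if_neg h]
  rw [Finset.sum_congr rfl fun B _ => this B, Finset.sum_comm]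
  simp

open Classical in
theorem sum_edge {M : Type*} [AddCommMonoid M] (c : Color) (v : G.Vertex) (f : G.Vertex → M) :
    (∑ w, if w ∈ (toResidue {c} v).1 then f w else 0) = f v + f (G.nbr c v) := by
  have : ∀ w, w ∈ (toResidue {c} v).1 ↔ w ∈ ({v, G.nbr c v} : Finset G.Vertex) := by
    intro w
    change w ∈ G.residue {c} v ↔ _
    rw [residue_singleton]; simp
  simp only [this]
  rw [Finset.sum_ite_mem, Finset.univ_inter, Finset.sum_pair (G.nbr_ne c v).symm]

open Classical in
-- The `c`-colored edges pair off the vertices of `A`, and the two values on each edge cancel.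
theorem sum_eq_zero_of_invariant {c : Color} {f : G.Vertex → ZMod 2}
    (hf : ∀ v, f (G.nbr c v) = f v) {A : Set G.Vertex} (hA : ∀ v ∈ A, G.nbr c v ∈ A) :
    (∑ v, if v ∈ A then f v else 0) = 0 := by
  have h := sum_residue {c} (fun _ => True) fun v => if v ∈ A then f v else 0
  simp only [if_true] at h
  rw [← h]
  refine Finset.sum_eq_zero fun B _ => ?_
  obtain ⟨v, rfl⟩ := exists_eq_toResidue B
  rw [sum_edge, hf]
  by_cases hv : v ∈ A
  · rw [if_pos hv, if_pos (hA v hv), CharTwo.add_self_eq_zero]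
  · rw [if_neg hv, if_neg, add_zero]
    intro h
    exact hv (by simpa [G.nbr_nbr] using hA _ h)

/-! ### Euler's formula, summed over the cells of one color -/

theorem card_vertex_eq (c : Color) :
    Fintype.card G.Vertex = 2 * Fintype.card (G.Residue {c}) := by
  classical
  have h := sum_residue (G := G) {c} (fun _ => True) fun _ => (1 : ℕ)
  simp only [if_true, Finset.sum_const, smul_eq_mul, mul_one, Finset.card_univ] at h
  rw [← h, Finset.sum_congr rfl (g := fun _ => 2), Finset.sum_const, smul_eq_mul, mul_comm,
    Finset.card_univ]
  intro B _
  obtain ⟨v, rfl⟩ := exists_eq_toResidue B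
  rw [sum_edge]

theorem sum_ncard_residue (T : Finset Color) :
    ∑ C : G.Residue T, C.1.ncard = Fintype.card G.Vertex := by
  classical
  have h := sum_residue (G := G) T (fun _ => True) fun _ => (1 : ℕ)
  simp only [if_true, Finset.sum_const, smul_eq_mul, mul_one, Finset.card_univ] at h
  rw [← h]
  refine Finset.sum_congr rfl fun C _ => ?_
  rw [← Finset.card_filter, Set.ncard_eq_toFinset_card']
  congr 1
  ext v; simp

theorem sum_countIn {S T : Finset Color} (h : S ⊆ T) :
    ∑ C : G.Residue T, G.countIn S C.1 = Fintype.card (G.Residue S) := by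
  classical
  have : ∀ C : G.Residue T, G.countIn S C.1 = ∑ B : G.Residue S, if B.1 ⊆ C.1 then 1 else 0 := by
    intro C
    rw [countIn, ← Finset.card_filter, Set.ncard_eq_toFinset_card']
    congr 1
    ext v; simp
  rw [Finset.sum_congr rfl fun C _ => this C, Finset.sum_comm,
    Finset.sum_congr rfl (g := fun _ => 1)]
  · simp
  · intro B _
    obtain ⟨v, rfl⟩ := exists_eq_toResidue B
    have : ∀ C : G.Residue T, (toResidue S v).1 ⊆ C.1 ↔ toResidue T v = C :=
      fun C => residue_subset_iff h
    simp [this]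

theorem Color.compl_singleton_eq {i j k d : Color} (h : [i, j, k, d].Nodup) :
    ({d}ᶜ : Finset Color) = {i, j, k} := by
  revert i j k d; decide

theorem Color.powersetCard_two {i j k d : Color} (h : [i, j, k, d].Nodup) :
    Finset.powersetCard 2 ({d}ᶜ : Finset Color) = {{i, j}, {i, k}, {j, k}} := by
  revert i j k d; decide

theorem Color.pairs_ne {i j k d : Color} (h : [i, j, k, d].Nodup) :
    ({i, j} : Finset Color) ≠ {i, k} ∧ ({i, j} : Finset Color) ≠ {j, k} ∧
      ({i, k} : Finset Color) ≠ {j, k} ∧ i ≠ j ∧ i ≠ k ∧ j ≠ k := by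
  revert i j k d; decide

/-- Summing Euler's formula over all `d`-cells counts each vertex, edge and plaquette without color
`d` once. The edges of each color number half the vertices, so vertices and two of the three edge
colors cancel. -/
theorem IsColorCodeLattice.euler (hG : G.IsColorCodeLattice) {i j k d : Color}
    (h : [i, j, k, d].Nodup) :
    Fintype.card (G.Residue {i, j}) + Fintype.card (G.Residue {i, k}) +
      Fintype.card (G.Residue {j, k}) =
      Fintype.card (G.Residue {i}) + 2 * Fintype.card (G.Residue {d}ᶜ) := by
  obtain ⟨h1, h2, h3, hij, hik, hjk⟩ := Color.pairs_ne h
  have hsum : ∑ C : G.Residue {d}ᶜ, (C.1.ncard + (G.countIn {i, j} C.1 + (G.countIn {i, k} C.1 +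
      G.countIn {j, k} C.1))) = ∑ C : G.Residue {d}ᶜ, (G.countIn {i} C.1 + (G.countIn {j} C.1 +
      G.countIn {k} C.1) + 2) := by
    refine Finset.sum_congr rfl fun C _ => ?_
    obtain ⟨v, rfl⟩ := exists_eq_toResidue C
    have := hG.spherical d v
    rw [Color.powersetCard_two h, Finset.sum_insert (by simp [h1, h2]),
      Finset.sum_pair h3] at this
    refine this.trans ?_
    have e := Color.compl_singleton_eq h
    have : ∑ c ∈ ({d}ᶜ : Finset Color), G.countIn {c} (G.cell d v) =
        ∑ c ∈ ({i, j, k} : Finset Color), G.countIn {c} (G.cell d v) := by rw [e]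
    rw [this, Finset.sum_insert (by simp [hij, hik]), Finset.sum_pair hjk]
    rfl
  have e := Color.compl_singleton_eq h
  simp only [Finset.sum_add_distrib, sum_ncard_residue] at hsum
  rw [sum_countIn (by rw [e]; intro c; simp; tauto), sum_countIn (by rw [e]; intro c; simp; tauto),
    sum_countIn (by rw [e]; intro c; simp; tauto), sum_countIn (by rw [e]; simp),
    sum_countIn (by rw [e]; simp), sum_countIn (by rw [e]; simp)] at hsum
  simp only [Finset.sum_const, smul_eq_mul, Finset.card_univ] at hsum
  have hi := card_vertex_eq (G := G) i
  have hj := card_vertex_eq (G := G) j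
  have hk := card_vertex_eq (G := G) k
  omega

/-! ### Exactness on the surfaces of the cells -/

/-- Used with one coordinate per `d`-cell, to bound spaces of functions that are constant on the
cells. -/
theorem finrank_ker_le_card {P ι : Type*} [Fintype P] [Fintype ι] {V : Type*} [AddCommGroup V]
    [Module (ZMod 2) V] (f : (P → ZMod 2) →ₗ[ZMod 2] V) (r : ι → P)
    (h : ∀ x, f x = 0 → (∀ i, x (r i) = 0) → x = 0) :
    Module.finrank (ZMod 2) (LinearMap.ker f) ≤ Fintype.card ι := by
  let g : LinearMap.ker f →ₗ[ZMod 2] (ι → ZMod 2) :=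
    (LinearMap.funLeft (ZMod 2) (ZMod 2) r).comp (LinearMap.ker f).subtype
  have hg : Function.Injective g := by
    rw [← LinearMap.ker_eq_bot, LinearMap.ker_eq_bot']
    rintro ⟨x, hx⟩ h0
    exact Subtype.ext (h x hx fun i => congrFun h0 i)
  simpa using LinearMap.finrank_le_finrank_of_injective hg

open Classical in
/-- On the surfaces of the cells of color `d`, every cocycle on the `i`-colored edges is the
coboundary of a function on the plaquettes without these edges. -/
theorem IsColorCodeLattice.exists_potential (hG : G.IsColorCodeLattice) {i j k d : Color}
    (h : [i, j, k, d].Nodup) (y : G.Residue {i} → ZMod 2)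
    (hj : ∀ F : G.Residue {i, j}, (∑ e : G.Residue {i}, if e.1 ⊆ F.1 then y e else 0) = 0)
    (hk : ∀ F : G.Residue {i, k}, (∑ e : G.Residue {i}, if e.1 ⊆ F.1 then y e else 0) = 0) :
    ∃ g : G.Residue {j, k} → ZMod 2, ∀ v, y (toResidue {i} v) =
      g (toResidue {j, k} v) + g (toResidue {j, k} (G.nbr i v)) := by
  have hcompl := Color.compl_singleton_eq h
  have ij : ({i} : Finset Color) ⊆ {i, j} := by simp
  have ik : ({i} : Finset Color) ⊆ {i, k} := by simp
  let repE : G.Residue {i} → G.Vertex := fun e => e.2.choose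
  have hrepE : ∀ e, toResidue {i} (repE e) = e := fun e => Subtype.ext e.2.choose_spec.symm
  let repC : G.Residue {d}ᶜ → G.Vertex := fun e => e.2.choose
  have hrepC : ∀ C, toResidue {d}ᶜ (repC C) = C := fun e => Subtype.ext e.2.choose_spec.symm
  -- A function constant along all edges other than those of color `d` is determined by one value
  -- per `d`-cell.
  have hconst : ∀ f : G.Vertex → ZMod 2, (∀ v, f (G.nbr i v) = f v) → (∀ v, f (G.nbr j v) = f v) →
      (∀ v, f (G.nbr k v) = f v) → (∀ C, f (repC C) = 0) → ∀ v, f v = 0 := by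
    intro f fi fj fk hC v
    rw [← hC (toResidue {d}ᶜ v)]
    refine eq_of_mem_residue (S := {d}ᶜ) ?_ ?_
    · rw [hcompl]
      intro c hc
      simp only [Finset.mem_insert, Finset.mem_singleton] at hc
      rcases hc with rfl | rfl | rfl <;> assumption
    · have : v ∈ (toResidue {d}ᶜ v).1 := mem_toResidue _ _
      rw [← hrepC (toResidue {d}ᶜ v)] at this
      exact this
  -- the coboundary
  let d₀ : (G.Residue {j, k} → ZMod 2) →ₗ[ZMod 2] (G.Residue {i} → ZMod 2) :=
    { toFun := fun g e => g (toResidue {j, k} (repE e)) + g (toResidue {j, k} (G.nbr i (repE e)))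
      map_add' := fun g g' => by funext e; simp only [Pi.add_apply]; abel
      map_smul' := fun a g => by
        funext e; simp only [Pi.smul_apply, smul_eq_mul, RingHom.id_apply]; ring }
  have hd₀ : ∀ g v, d₀ g (toResidue {i} v) =
      g (toResidue {j, k} v) + g (toResidue {j, k} (G.nbr i v)) := by
    intro g v
    have : repE (toResidue {i} v) ∈ (toResidue {i} v).1 :=
      mem_iff_toResidue_eq.2 (hrepE _)
    change _ ∈ G.residue {i} v at this
    rw [residue_singleton] at this
    change g _ + g _ = _
    rcases this with e | e
    · rw [e]
    · rw [e, G.nbr_nbr, add_comm]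
  -- the face conditions
  let M : Matrix (G.Residue {i, j} ⊕ G.Residue {i, k}) (G.Residue {i}) (ZMod 2) :=
    fun F e => Sum.elim (fun F => if e.1 ⊆ F.1 then 1 else 0)
      (fun F => if e.1 ⊆ F.1 then 1 else 0) F
  have hMl : ∀ F e, M (.inl F) e = if e.1 ⊆ F.1 then 1 else 0 := fun _ _ => rfl
  have hMr : ∀ F e, M (.inr F) e = if e.1 ⊆ F.1 then 1 else 0 := fun _ _ => rfl
  have hMT : ∀ x v, M.transpose.mulVec x (toResidue {i} v) =
      x (.inl (toResidue {i, j} v)) + x (.inr (toResidue {i, k} v)) := by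
    intro x v
    have h1 : ∀ F : G.Residue {i, j}, (toResidue {i} v).1 ⊆ F.1 ↔ toResidue {i, j} v = F :=
      fun F => residue_subset_iff ij
    have h2 : ∀ F : G.Residue {i, k}, (toResidue {i} v).1 ⊆ F.1 ↔ toResidue {i, k} v = F :=
      fun F => residue_subset_iff ik
    simp [Matrix.mulVec, dotProduct, hMl, hMr, h1, h2]
  -- A vector in the kernel has equal values on the two faces beside each edge, so it is constant on
  -- each cell.
  have hkerM : Module.finrank (ZMod 2) (LinearMap.ker M.transpose.mulVecLin) ≤
      Fintype.card (G.Residue {d}ᶜ) := by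
    refine finrank_ker_le_card _ (fun C => .inl (toResidue {i, j} (repC C))) fun x hx hC => ?_
    have hp : ∀ v, x (.inl (toResidue {i, j} v)) = x (.inr (toResidue {i, k} v)) := fun v => by
      have := congrFun hx (toResidue {i} v)
      rw [Matrix.mulVecLin_apply, hMT] at this
      exact CharTwo.add_eq_zero.1 this
    have h0 := hconst (fun v => x (.inl (toResidue {i, j} v)))
      (fun v => by rw [toResidue_nbr (by simp)]) (fun v => by rw [toResidue_nbr (by simp)])
      (fun v => by simp only [hp]; rw [toResidue_nbr (by simp)]) hC
    funext F
    rcases F with F | F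
    · obtain ⟨v, rfl⟩ := exists_eq_toResidue F
      exact h0 v
    · obtain ⟨v, rfl⟩ := exists_eq_toResidue F
      exact (hp v).symm.trans (h0 v)
  have hkerd : Module.finrank (ZMod 2) (LinearMap.ker d₀) ≤ Fintype.card (G.Residue {d}ᶜ) := by
    refine finrank_ker_le_card _ (fun C => toResidue {j, k} (repC C)) fun x hx hC => ?_
    have h0 := hconst (fun v => x (toResidue {j, k} v))
      (fun v => by
        have := congrFun hx (toResidue {i} v)
        rw [hd₀] at this
        exact (CharTwo.add_eq_zero.1 this).symm)
      (fun v => by rw [toResidue_nbr (by simp)]) (fun v => by rw [toResidue_nbr (by simp)]) hC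
    funext F
    obtain ⟨v, rfl⟩ := exists_eq_toResidue F
    exact h0 v
  have hface : ∀ (g : G.Residue {j, k} → ZMod 2) (l : Color), l ∈ ({j, k} : Finset Color) →
      ∀ F : G.Residue {i, l}, (∑ e : G.Residue {i}, if e.1 ⊆ F.1 then d₀ g e else 0) = 0 := by
    intro g l hl F
    have h1 := sum_residue {i} (fun e => e.1 ⊆ F.1) fun v => g (toResidue {j, k} v)
    have h2 : ∀ e : G.Residue {i}, (∑ v, if v ∈ e.1 then g (toResidue {j, k} v) else 0) =
        d₀ g e := by
      intro e
      obtain ⟨v, rfl⟩ := exists_eq_toResidue e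
      rw [sum_edge, hd₀]
    simp only [h2] at h1
    rw [h1]
    have h3 : ∀ v, (toResidue {i} v).1 ⊆ F.1 ↔ v ∈ F.1 := fun v => by
      rw [mem_iff_toResidue_eq]; exact residue_subset_iff (by simp)
    simp only [h3]
    -- The face sum has become a sum over the vertices of `F`; the potential is constant along
    -- `l`-edges, so its terms cancel in pairs.
    refine sum_eq_zero_of_invariant (c := l) (fun v => by rw [toResidue_nbr hl]) fun v hv => ?_
    obtain ⟨w, rfl⟩ := exists_eq_toResidue F
    exact nbr_mem_residue (by simp) hv
  have hkerMem : ∀ x, x ∈ LinearMap.ker M.mulVecLin ↔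
      (∀ F : G.Residue {i, j}, (∑ e : G.Residue {i}, if e.1 ⊆ F.1 then x e else 0) = 0) ∧
      (∀ F : G.Residue {i, k}, (∑ e : G.Residue {i}, if e.1 ⊆ F.1 then x e else 0) = 0) := by
    intro x
    rw [LinearMap.mem_ker, funext_iff, Sum.forall]
    simp [Matrix.mulVec, dotProduct, hMl, hMr]
  have hle : LinearMap.range d₀ ≤ LinearMap.ker M.mulVecLin := by
    rintro _ ⟨g, rfl⟩
    exact (hkerMem _).2 ⟨hface g j (by simp), hface g k (by simp)⟩
  -- Let `V`, `E`, `F` count vertices, edges and faces of the shrunk surfaces and `C` the cells. The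
  -- kernel of `M` has dimension at most `E - F + C`, the range of `d₀` at least `V - C`, and
  -- Euler's formula `V - E + F = 2C` makes the bounds equal.
  have hfin : Module.finrank (ZMod 2) (LinearMap.ker M.mulVecLin) ≤
      Module.finrank (ZMod 2) (LinearMap.range d₀) := by
    have r1 := LinearMap.finrank_range_add_finrank_ker M.mulVecLin
    have r2 := LinearMap.finrank_range_add_finrank_ker M.transpose.mulVecLin
    have r3 := LinearMap.finrank_range_add_finrank_ker d₀
    have r4 : M.transpose.rank = M.rank := Matrix.rank_transpose M
    rw [Matrix.rank, Matrix.rank] at r4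
    have r5 := hG.euler h
    rw [Module.finrank_fintype_fun_eq_card] at r1 r2 r3
    rw [Fintype.card_sum] at r2
    omega
  have hmem : y ∈ LinearMap.range d₀ := by
    rw [Submodule.eq_of_le_of_finrank_le hle hfin]
    exact (hkerMem y).2 ⟨hj, hk⟩
  obtain ⟨g, rfl⟩ := hmem
  exact ⟨g, fun v => hd₀ g v⟩

end ColoredGraph

/-! ### Excitations and condensation -/

namespace ColoredGraph

variable {G : ColoredGraph.{u}} {K : Finset G.Vertex}

theorem CutsOnly.nbr_mem {d : Color} (hK : G.CutsOnly d K) {c : Color} (hc : c ≠ d) {v : G.Vertex}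
    (hv : v ∈ K) : G.nbr c v ∈ K := by
  by_contra h
  exact hc (hK c v hv h)

theorem CutsOnly.residue_subset {d : Color} (hK : G.CutsOnly d K) {S : Finset Color} (hS : d ∉ S)
    {v : G.Vertex} (hv : v ∈ K) : G.residue S v ⊆ K :=
  ColoredGraph.residue_subset hv fun _ hc _ hw =>
    Finset.mem_coe.2 (hK.nbr_mem (fun e => hS (e ▸ hc)) (Finset.mem_coe.1 hw))

/-- Extension of a vector of kept qubits by zero. -/
def extendZero (x : K → ZMod 2) (v : G.Vertex) : ZMod 2 := if h : v ∈ K then x ⟨v, h⟩ else 0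

open Classical in
theorem charVec_apply {Q : Type*} (A : Set Q) (q : Q) :
    charVec A q = if q ∈ A then (1 : ZMod 2) else 0 := by
  rw [charVec, Set.indicator_apply]

theorem extendZero_coe (x : K → ZMod 2) (v : K) : extendZero x v.1 = x v := by
  simp [extendZero]

theorem extendZero_of_notMem (x : K → ZMod 2) {v : G.Vertex} (hv : v ∉ K) :
    extendZero x v = 0 := by
  simp [extendZero, hv]

open Classical in
theorem restrict_dotProduct (A : Set G.Vertex) (x : K → ZMod 2) :
    G.restrict K A ⬝ᵥ x = ∑ v, if v ∈ A then extendZero x v else 0 := by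
  have h : ∑ v, (if v ∈ A then extendZero x v else 0) =
      ∑ v ∈ K, if v ∈ A then extendZero x v else 0 := by
    refine (Finset.sum_subset (Finset.subset_univ K) fun v _ hv => ?_).symm
    rw [extendZero_of_notMem x hv, ite_self]
  rw [h, ← Finset.sum_coe_sort K, dotProduct]
  refine Finset.sum_congr rfl fun v _ => ?_
  rw [extendZero_coe, restrict, charVec_apply, ite_mul, one_mul, zero_mul]

open Classical in
theorem charVec_dotProduct (A : Set G.Vertex) (x : G.Vertex → ZMod 2) :
    charVec A ⬝ᵥ x = ∑ v, if v ∈ A then x v else 0 :=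
  Finset.sum_congr rfl fun v _ => by rw [charVec_apply, ite_mul, one_mul, zero_mul]

/-- Every `X`-operator terminates on an `X`-boundary. -/
theorem xTerminates (x : G.Vertex → ZMod 2) : G.XTerminates K x := by
  classical
  refine ⟨fun c v _ _ => pauliX_comm _ _, fun c v _ => ?_, fun P v _ hK => ?_⟩
  · simp only [violates_pauliX_pauliX]
  · rw [violates_pauliX_pauliZ, violates_pauliX_pauliZ, restrict_dotProduct, charVec_dotProduct]
    rw [Finset.sum_congr rfl fun w _ => ?_]
    by_cases hw : w ∈ G.residue P v
    · rw [if_pos hw, if_pos hw]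
      exact extendZero_coe (fun q : K => x q) ⟨w, hK hw⟩
    · rw [if_neg hw, if_neg hw]

theorem ite_ne_zero_eq (a : ZMod 2) : (if a ≠ 0 then (1 : ZMod 2) else 0) = a := by
  revert a; decide

/-- The total charge created in the bulk is trivial. -/
theorem charges_eq {x z : K → ZMod 2} (h : G.NoBoundaryExcitation K (pauli x z)) (c : Color) :
    G.charges K (pauli x z) c = ∑ v, extendZero z v := by
  classical
  have h1 := sum_residue {c}ᶜ (fun _ => True) (extendZero z)
  simp only [if_true] at h1
  rw [← h1, charges]
  refine Finset.sum_congr rfl fun C _ => ?_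
  rw [violates_pauli_pauliX, dotProduct_comm, restrict_dotProduct]
  by_cases hC : C.1 ⊆ K
  · rw [← ite_ne_zero_eq (∑ v, _)]
    simp [hC]
  -- Cells that are not intact may be added to the sum: a cut cell contributes zero by hypothesis,
  -- and a cell disjoint from `K` has no support.
  · rw [if_neg (fun h => hC h.1), ← restrict_dotProduct]
    by_cases hm : ∃ v ∈ K, v ∈ C.1
    · obtain ⟨v, hv, hvC⟩ := hm
      have e : C.1 = G.cell c v := congrArg Subtype.val (mem_iff_toResidue_eq.1 hvC).symm
      have := h c v hv (by rwa [← e])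
      rw [commute_pauli_pauliX, ← e, dotProduct_comm] at this
      exact this.symm
    · push Not at hm
      rw [restrict_dotProduct]
      refine (Finset.sum_eq_zero fun v _ => ?_).symm
      by_cases hv : v ∈ K
      · rw [if_neg (hm v hv)]
      · rw [extendZero_of_notMem z hv, ite_self]

theorem mk_charges {x z : K → ZMod 2} (h : G.NoBoundaryExcitation K (pauli x z)) :
    (Submodule.Quotient.mk (G.charges K (pauli x z)) : ChargeType) = 0 := by
  rw [Submodule.Quotient.mk_eq_zero, Submodule.mem_span_singleton]
  exact ⟨∑ v, extendZero z v, funext fun c => by simp [charges_eq h]⟩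

/-! ### The flux emitted by single-qubit `X`-operators -/

open Classical in
/-- The flux through the plaquettes of the `c`-colored cell at `v` that `X(v)` creates. -/
noncomputable def vertexFlux (K : Finset G.Vertex) (c : Color) (v : G.Vertex) (P : ColorPair) :
    ZMod 2 :=
  if c ∈ P.1 ∧ G.residue P.1ᶜ v ⊆ K then 1 else 0

open Classical in
-- The violation parity of a plaquette is the sum of `x` over its vertices, and a plaquette of the
-- relevant kind lies in the cell as soon as one of its vertices does. Exchanging the sums leaves
-- one contribution per vertex.
theorem fluxThrough_eq (x z : K → ZMod 2) (c : Color) (u : G.Vertex) :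
    G.fluxThrough K (pauli x z) c (G.cell c u) =
      ∑ v, (if v ∈ G.cell c u then extendZero x v else 0) • vertexFlux K c v := by
  funext P
  rw [Finset.sum_apply]
  have h := sum_residue P.1ᶜ (fun F : G.Residue P.1ᶜ => c ∈ P.1 ∧ F.1 ⊆ G.cell c u ∧ F.1 ⊆ K)
    (extendZero x)
  rw [fluxThrough]
  refine Eq.trans ?_ (h.trans ?_)
  · refine Finset.sum_congr rfl fun F _ => ?_
    rw [violates_pauli_pauliZ, restrict_dotProduct]
    by_cases hF : c ∈ P.1 ∧ F.1 ⊆ G.cell c u ∧ F.1 ⊆ K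
    · rw [if_pos hF, ← ite_ne_zero_eq (∑ v, _)]
      simp [hF]
    · rw [if_neg hF, if_neg]
      exact fun h => hF ⟨h.1, h.2.1, h.2.2.1⟩
  · refine Finset.sum_congr rfl fun v _ => ?_
    rw [Pi.smul_apply, vertexFlux, smul_eq_mul]
    by_cases hc : c ∈ P.1
    · have e : (toResidue P.1ᶜ v).1 ⊆ G.cell c u ↔ v ∈ G.cell c u := by
        have h1 : P.1ᶜ ⊆ {c}ᶜ := by simpa using hc
        exact (residue_subset_iff (C := toResidue {c}ᶜ u) h1).trans mem_iff_toResidue_eq.symm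
      by_cases hv : v ∈ G.cell c u
      · have e' : (toResidue P.1ᶜ v).1 = G.residue P.1ᶜ v := rfl
        rw [e'] at e
        simp [hc, hv, e, e']
      · simp [hv, e]
    · simp [hc]

theorem Color.eq_or {i j k d : Color} (h : [i, j, k, d].Nodup) (l : Color) :
    l = i ∨ l = j ∨ l = k ∨ l = d := by
  revert i j k d l; decide

theorem Color.compl_pair_eq {i j k d : Color} (h : [i, j, k, d].Nodup) :
    ({i, j}ᶜ : Finset Color) = {k, d} ∧ ({i, k}ᶜ : Finset Color) = {j, d} ∧
      ({i, d}ᶜ : Finset Color) = {j, k} := by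
  revert i j k d; decide

theorem Color.pair_ne_pair {i j k d : Color} (h : [i, j, k, d].Nodup) :
    ({i, j} : Finset Color) ≠ {i, k} ∧ ({i, d} : Finset Color) ≠ {i, j} ∧
      ({i, d} : Finset Color) ≠ {i, k} ∧ d ≠ j ∧ d ≠ k ∧ d ≠ i := by
  revert i j k d; decide

theorem Color.pair_eq_or {i j k d : Color} (h : [i, j, k, d].Nodup) {P : Finset Color}
    (hP : P.card = 2) (hi : i ∈ P) : P = {i, j} ∨ P = {i, k} ∨ P = {i, d} := by
  obtain ⟨a, b, hab, rfl⟩ := Finset.card_eq_two.1 hP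
  have : ∃ l, l ≠ i ∧ ({a, b} : Finset Color) = {i, l} := by
    rcases Finset.mem_insert.1 hi with rfl | hi
    · exact ⟨b, hab.symm, rfl⟩
    · rw [Finset.mem_singleton] at hi
      subst hi
      exact ⟨a, hab, Finset.pair_comm _ _⟩
  obtain ⟨l, hl, e⟩ := this
  rw [e]
  rcases Color.eq_or h l with rfl | rfl | rfl | rfl
  · exact absurd rfl hl
  all_goals simp

open Classical in
/-- Whether the plaquette with edges of colors `i` and `d` at `v` is cut. -/
noncomputable def cutParity (K : Finset G.Vertex) (d i : Color) (v : G.Vertex) : ZMod 2 :=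
  if G.residue {i, d} v ⊆ K then 0 else 1

/-- The plaquette between cells of colors `i` and `j` has edges of colors `k` and `d`, which is why
a cut in direction `k` supplies the loop of `i` and `j`. Adding back the loops of the cut plaquettes
completes the flux to the fusion relation at `i`; the plaquette with edges `j`, `k` is never cut. -/
theorem mk_vertexFlux {i j k d : Color} (h : [i, j, k, d].Nodup) (hK : G.CutsOnly d K)
    {v : G.Vertex} (hv : v ∈ K) :
    ((0, Submodule.Quotient.mk (vertexFlux K i v)) : Excitation) =
      cutParity K d k v • fluxLoop i j + cutParity K d j v • fluxLoop i k := by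
  classical
  obtain ⟨e1, e2, e3⟩ := Color.compl_pair_eq h
  obtain ⟨n1, n2, n3, n4, n5, n6⟩ := Color.pair_ne_pair h
  refine Prod.ext (by simp [fluxLoop]) ?_
  simp only [fluxLoop, Prod.snd_add, Prod.smul_snd, ← Submodule.Quotient.mk_smul,
    ← Submodule.Quotient.mk_add]
  rw [Submodule.Quotient.eq]
  refine Submodule.subset_span ⟨i, funext fun P => ?_⟩
  simp only [Pi.sub_apply, Pi.add_apply, Pi.smul_apply, smul_eq_mul, vertexFlux, cutParity]
  by_cases hi : i ∈ P.1
  · rcases Color.pair_eq_or h P.2 hi with hP | hP | hP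
    · rw [hP, e1]
      by_cases hc : G.residue {k, d} v ⊆ K <;> simp [hc, n1]
    · rw [hP, e2]
      by_cases hc : G.residue {j, d} v ⊆ K <;> simp [hc, n1.symm]
    · have hc : G.residue {j, k} v ⊆ K := hK.residue_subset (by simp [n4, n5]) hv
      rw [hP, e3]
      simp [hc, n2, n3]
  · have h1 : P.1 ≠ {i, j} := fun e => hi (by simp [e])
    have h2 : P.1 ≠ {i, k} := fun e => hi (by simp [e])
    simp [hi, h1, h2]

/-- The plaquettes of a `d`-cell have no `d`-colored edges, hence none at `v` is cut and the flux is
exactly the fusion relation at `d`. -/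
theorem mk_vertexFlux_self {d : Color} (hK : G.CutsOnly d K) {v : G.Vertex} (hv : v ∈ K) :
    ((0, Submodule.Quotient.mk (vertexFlux K d v)) : Excitation) = 0 := by
  classical
  refine Prod.ext rfl ?_
  change (Submodule.Quotient.mk _ : FluxType) = 0
  rw [Submodule.Quotient.mk_eq_zero]
  refine Submodule.subset_span ⟨d, funext fun P => ?_⟩
  by_cases hd : d ∈ P.1
  · have : G.residue P.1ᶜ v ⊆ K := hK.residue_subset (by simpa using hd) hv
    simp [vertexFlux, hd, this]
  · simp [vertexFlux, hd]

theorem smul_mem_addSubgroup {M : Type*} [AddCommGroup M] [Module (ZMod 2) M] {H : AddSubgroup M}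
    {x : M} (hx : x ∈ H) (a : ZMod 2) : a • x ∈ H := by
  rcases zmod_two_cases a with rfl | rfl
  · rw [zero_smul]; exact zero_mem _
  · rwa [one_smul]

theorem fluxLoop_comm (a b : Color) : fluxLoop a b = fluxLoop b a := by
  rw [fluxLoop, fluxLoop, Finset.pair_comm]

theorem Color.exists_third {i j d : Color} (hij : i ≠ j) (hi : i ≠ d) (hj : j ≠ d) :
    ∃ k, [i, j, k, d].Nodup := by
  revert i j d; decide

theorem Color.nodup_rotate {i j k d : Color} (h : [i, j, k, d].Nodup) : [k, i, j, d].Nodup := by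
  revert i j k d; decide

theorem Color.nodup_swap {i j k d : Color} (h : [i, j, k, d].Nodup) : [j, i, k, d].Nodup := by
  revert i j k d; decide

theorem Color.ne_of_nodup {i j k d : Color} (h : [i, j, k, d].Nodup) :
    i ≠ j ∧ i ≠ k ∧ i ≠ d ∧ j ≠ k ∧ j ≠ d ∧ k ≠ d := by
  revert i j k d; decide

/-- The charge is always trivial and the flux is a sum of vertex fluxes, so these generate
everything. -/
theorem condensationGroup_le {H : AddSubgroup Excitation}
    (h : ∀ c, ∀ v ∈ K, ((0, Submodule.Quotient.mk (vertexFlux K c v)) : Excitation) ∈ H) :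
    G.condensationGroup K ≤ H := by
  classical
  rw [condensationGroup, AddSubgroup.closure_le]
  rintro _ ⟨x, z, hxz, c, u, -, rfl⟩
  rw [mk_charges hxz, fluxThrough_eq]
  have : ((0, Submodule.Quotient.mk (∑ v, (if v ∈ G.cell c u then extendZero x v else 0) •
      vertexFlux K c v)) : Excitation) = ∑ v, (if v ∈ G.cell c u then extendZero x v else 0) •
        (0, Submodule.Quotient.mk (vertexFlux K c v)) := by
    refine Prod.ext ?_ ?_
    · rw [Prod.fst_sum]
      exact (Finset.sum_eq_zero fun v _ => smul_zero _).symm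
    rw [Prod.snd_sum]
    exact map_sum (Submodule.mkQ _) _ _
  rw [this]
  refine AddSubgroup.sum_mem _ fun v _ => ?_
  by_cases hv : v ∈ K
  · exact smul_mem_addSubgroup (h c v hv) _
  · rw [extendZero_of_notMem x hv, ite_self, zero_smul]
    exact zero_mem _

theorem vertexFlux_mem_condensationGroup (c : Color) {v : G.Vertex} (hv : v ∈ K) :
    ((0, Submodule.Quotient.mk (vertexFlux K c v)) : Excitation) ∈ G.condensationGroup K := by
  classical
  have hno : G.NoBoundaryExcitation K (pauli (Pi.single ⟨v, hv⟩ 1) 0) := fun c u _ _ => by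
    rw [commute_pauli_pauliX, zero_dotProduct]
  refine AddSubgroup.subset_closure ⟨Pi.single ⟨v, hv⟩ 1, 0, hno, c, v, hv, ?_⟩
  rw [mk_charges hno, fluxThrough_eq, Finset.sum_eq_single v]
  · have : extendZero (Pi.single ⟨v, hv⟩ 1 : K → ZMod 2) v = 1 := by simp [extendZero, hv]
    rw [if_pos (mem_residue_self _ _), this, one_smul]
  · intro w _ hw
    have : extendZero (Pi.single ⟨v, hv⟩ 1 : K → ZMod 2) w = 0 := by
      by_cases hwK : w ∈ K
      · simp [extendZero, hwK, hw]
      · exact extendZero_of_notMem _ hwK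
    rw [this, ite_self, zero_smul]
  · simp

/-- In a connected lattice, a nonempty proper side `K` has a cut edge at one of its vertices. -/
theorem exists_nbr_notMem (hG : G.IsColorCodeLattice) {A : Set G.Vertex} {v w : G.Vertex}
    (hv : v ∈ A) (hw : w ∉ A) : ∃ u ∈ A, ∃ c, G.nbr c u ∉ A := by
  by_contra! h
  exact hw (residue_subset hv (fun c _ u hu => h u hu c) (hG.connected v w))

/-- The flux loops that condense: if `K` is a proper side with an intact plaquette that has
`d`-colored edges, these are the loops of all pairs of colors other than `d`. -/
theorem fluxLoop_mem_condensationGroup (hG : G.IsColorCodeLattice) {d : Color}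
    (hK : G.CutsOnly d K) (hne : ∃ v, v ∉ K) (hpl : ∃ c, c ≠ d ∧ ∃ v, G.residue {c, d} v ⊆ K)
    {a b : Color} (hab : a ≠ b) (ha : a ≠ d) (hb : b ≠ d) :
    fluxLoop a b ∈ G.condensationGroup K := by
  obtain ⟨w, hw⟩ := hne
  obtain ⟨c, hc, v, hv⟩ := hpl
  have hvK : v ∈ K := hv (mem_residue_self _ v)
  -- a vertex at which all plaquettes with `d`-colored edges are cut
  obtain ⟨t, ht, c', hc'⟩ := exists_nbr_notMem hG (A := (K : Set G.Vertex)) hvK hw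
  obtain rfl : c' = d := hK c' t ht hc'
  have hcut : ∀ i, cutParity K c' i t = 1 := fun i => by
    rw [cutParity, if_neg]
    exact fun h => hc' (h (nbr_mem_residue (by simp) (mem_residue_self _ t)))
  -- a vertex at which some, but not all of them are cut
  have hmix : ∃ s ∈ K, ∃ i j, i ≠ c' ∧ j ≠ c' ∧ ¬ G.residue {i, c'} s ⊆ K ∧
      G.residue {j, c'} s ⊆ K := by
    by_contra! hno
    have hall : ∀ s, s ∈ K → ∀ j, j ≠ c' → G.residue {j, c'} s ⊆ K → ∀ i, i ≠ c' →
        G.residue {i, c'} s ⊆ K := fun s hs j hj hjs i hi => by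
      by_contra h
      exact hno s hs i j hi hj h hjs
    -- Without a mixed vertex, the set of vertices with all `d`-plaquettes intact is closed under
    -- every edge: a `d`-edge stays in all of these plaquettes, while an `e`-edge with `e ≠ d` stays
    -- in the `{e, d}`-plaquette, and one intact plaquette then forces the others. This contradicts
    -- connectivity.
    obtain ⟨s, ⟨hs, hs'⟩, e, he⟩ := exists_nbr_notMem hG
      (A := {s | s ∈ K ∧ ∀ i, i ≠ c' → G.residue {i, c'} s ⊆ K}) (v := v) (w := w)
      ⟨hvK, hall v hvK c hc hv⟩ fun h => hw h.1
    refine he ?_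
    by_cases hec : e = c'
    · subst hec
      refine ⟨hs' c hc (nbr_mem_residue (by simp) (mem_residue_self _ s)), fun i hi => ?_⟩
      rw [residue_nbr (by simp)]
      exact hs' i hi
    · have := hK.nbr_mem hec hs
      refine ⟨this, hall _ this e hec ?_⟩
      rw [residue_nbr (by simp)]
      exact hs' e hec
  obtain ⟨s, hs, i, j, hi, hj, hci, hcj⟩ := hmix
  have hij : i ≠ j := by rintro rfl; exact hci hcj
  obtain ⟨k, hnd⟩ := Color.exists_third hij hi hj
  have hnd1 : [k, i, j, c'].Nodup := Color.nodup_rotate hnd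
  have hnd2 : [j, i, k, c'].Nodup := Color.nodup_swap hnd
  -- The mixed vertex isolates one loop; the fully cut vertex gives sums of two loops, from which
  -- the others are obtained by subtraction.
  have hkj : fluxLoop k j ∈ G.condensationGroup K := by
    have := vertexFlux_mem_condensationGroup k hs
    rw [mk_vertexFlux hnd1 hK hs] at this
    simpa [cutParity, hci, hcj] using this
  have hki : fluxLoop k i ∈ G.condensationGroup K := by
    have := vertexFlux_mem_condensationGroup k ht
    rw [mk_vertexFlux hnd1 hK ht, hcut, hcut, one_smul, one_smul] at this
    simpa using sub_mem this hkj
  have hji : fluxLoop j i ∈ G.condensationGroup K := by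
    have := vertexFlux_mem_condensationGroup j ht
    rw [mk_vertexFlux hnd2 hK ht, hcut, hcut, one_smul, one_smul, fluxLoop_comm j k] at this
    simpa using sub_mem this hkj
  rcases Color.eq_or hnd a with rfl | rfl | rfl | rfl
  all_goals rcases Color.eq_or hnd b with rfl | rfl | rfl | rfl
  all_goals first
    | exact absurd rfl ha | exact absurd rfl hb | exact absurd rfl hab | assumption
    | (rw [fluxLoop_comm]; assumption)

theorem condensationGroup_eq (hG : G.IsColorCodeLattice) {c₁ c₂ c₃ c₄ : Color}
    (h : [c₁, c₂, c₃, c₄].Nodup) (hK : G.CutsOnly c₄ K) (hne : ∃ v, v ∉ K)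
    (hpl : ∃ c, c ≠ c₄ ∧ ∃ v, G.residue {c, c₄} v ⊆ K) :
    G.condensationGroup K =
      AddSubgroup.closure {fluxLoop c₂ c₃, fluxLoop c₁ c₃, fluxLoop c₁ c₂} := by
  obtain ⟨h12, h13, h14, h23, h24, h34⟩ := Color.ne_of_nodup h
  refine le_antisymm (condensationGroup_le fun c v hv => ?_) ?_
  · have h1 : fluxLoop c₂ c₃ ∈ AddSubgroup.closure
        {fluxLoop c₂ c₃, fluxLoop c₁ c₃, fluxLoop c₁ c₂} :=
      AddSubgroup.subset_closure (by simp)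
    have h2 : fluxLoop c₁ c₃ ∈ AddSubgroup.closure
        {fluxLoop c₂ c₃, fluxLoop c₁ c₃, fluxLoop c₁ c₂} :=
      AddSubgroup.subset_closure (by simp)
    have h3 : fluxLoop c₁ c₂ ∈ AddSubgroup.closure
        {fluxLoop c₂ c₃, fluxLoop c₁ c₃, fluxLoop c₁ c₂} :=
      AddSubgroup.subset_closure (by simp)
    rcases Color.eq_or h c with rfl | rfl | rfl | rfl
    · rw [mk_vertexFlux h hK hv]
      exact add_mem (smul_mem_addSubgroup h3 _) (smul_mem_addSubgroup h2 _)
    · have : [c, c₁, c₃, c₄].Nodup := Color.nodup_swap h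
      rw [mk_vertexFlux this hK hv, fluxLoop_comm c c₁]
      exact add_mem (smul_mem_addSubgroup h3 _) (smul_mem_addSubgroup h1 _)
    · have : [c, c₁, c₂, c₄].Nodup := Color.nodup_rotate h
      rw [mk_vertexFlux this hK hv, fluxLoop_comm c c₁, fluxLoop_comm c c₂]
      exact add_mem (smul_mem_addSubgroup h2 _) (smul_mem_addSubgroup h1 _)
    · rw [mk_vertexFlux_self hK hv]
      exact zero_mem _
  · rw [AddSubgroup.closure_le]
    rintro _ (rfl | rfl | rfl)
    · exact fluxLoop_mem_condensationGroup hG hK hne hpl h23 h24 h34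
    · exact fluxLoop_mem_condensationGroup hG hK hne hpl h13 h14 h34
    · exact fluxLoop_mem_condensationGroup hG hK hne hpl h12 h14 h24

end ColoredGraph

/-! ### The unfolding map -/

namespace ColoredGraph

variable {G : ColoredGraph.{u}} {K : Finset G.Vertex} {d : Color}

theorem CutsOnly.edge_subset (hK : G.CutsOnly d K) {i : Color} (hi : i ≠ d) {v : G.Vertex}
    (hv : v ∈ K) : (toResidue {i} v).1 ⊆ (K : Set G.Vertex) :=
  hK.residue_subset (by simpa using hi.symm) hv

/-- The qubit of the toric codes on the `i`-colored edge at the kept vertex `v`. -/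
def edgeQubit (hK : G.CutsOnly d K) {i : Color} (hi : i ≠ d) {v : G.Vertex} (hv : v ∈ K) :
    G.ToricQubit K d :=
  ⟨⟨i, hi⟩, ⟨toResidue {i} v, hK.edge_subset hi hv⟩⟩

/-- The edge of a qubit of the toric codes. -/
def qubitEdge (r : G.ToricQubit K d) : Set G.Vertex := r.2.1.1

/-- An end of the edge of a qubit of the toric codes. -/
noncomputable def qubitEnd (r : G.ToricQubit K d) : G.Vertex := r.2.1.2.choose

theorem qubitEdge_eq (r : G.ToricQubit K d) :
    qubitEdge r = G.residue {r.1.1} (qubitEnd r) := r.2.1.2.choose_spec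

theorem qubitEnd_mem (r : G.ToricQubit K d) : qubitEnd r ∈ K := by
  have h : qubitEdge r ⊆ K := r.2.2
  rw [qubitEdge_eq] at h
  exact h (mem_residue_self _ _)

theorem exists_eq_edgeQubit (hK : G.CutsOnly d K) (r : G.ToricQubit K d) :
    ∃ (i : Color) (hi : i ≠ d) (v : G.Vertex) (hv : v ∈ K), r = edgeQubit hK hi hv := by
  refine ⟨r.1.1, r.1.2, qubitEnd r, qubitEnd_mem r, ?_⟩
  obtain ⟨⟨i, hi⟩, ⟨e, he⟩⟩ := r
  refine Sigma.ext rfl (heq_of_eq (Subtype.ext (Subtype.ext ?_)))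
  exact qubitEdge_eq ⟨⟨i, hi⟩, ⟨e, he⟩⟩

theorem extendZero_add (x x' : K → ZMod 2) (v : G.Vertex) :
    extendZero (x + x') v = extendZero x v + extendZero x' v := by
  by_cases hv : v ∈ K <;> simp [extendZero, hv]

theorem extendZero_smul (a : ZMod 2) (x : K → ZMod 2) (v : G.Vertex) :
    extendZero (a • x) v = a * extendZero x v := by
  by_cases hv : v ∈ K <;> simp [extendZero, hv]

/-- The sum of the values at the two ends of each edge. -/
noncomputable def edgeSums (K : Finset G.Vertex) (d : Color) :
    (K → ZMod 2) →ₗ[ZMod 2] (G.ToricQubit K d → ZMod 2) where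
  toFun x r := G.restrict K (qubitEdge r) ⬝ᵥ x
  map_add' x y := by funext r; exact dotProduct_add _ _ _
  map_smul' a x := by funext r; exact dotProduct_smul _ _ _

theorem edgeSums_apply (x : K → ZMod 2) (r : G.ToricQubit K d) :
    edgeSums K d x r = extendZero x (qubitEnd r) + extendZero x (G.nbr r.1.1 (qubitEnd r)) := by
  change G.restrict K (qubitEdge r) ⬝ᵥ x = _
  rw [restrict_dotProduct, qubitEdge_eq]
  exact sum_edge _ _ _

theorem edgeSums_edgeQubit (hK : G.CutsOnly d K) {i : Color} (hi : i ≠ d) {v : G.Vertex}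
    (hv : v ∈ K) (x : K → ZMod 2) :
    edgeSums K d x (edgeQubit hK hi hv) = extendZero x v + extendZero x (G.nbr i v) := by
  change G.restrict K (toResidue {i} v).1 ⬝ᵥ x = _
  rw [restrict_dotProduct]
  exact sum_edge _ _ _

/-- The kept cells of color `d`. -/
def KeptCell (K : Finset G.Vertex) (d : Color) : Type u :=
  {C : G.Residue {d}ᶜ // C.1 ⊆ (K : Set G.Vertex)}

noncomputable instance : Fintype (KeptCell K d) := by
  classical
  unfold KeptCell
  infer_instance

noncomputable instance : DecidableEq (KeptCell K d) := Classical.decEq _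

/-- A vertex of a kept cell. -/
noncomputable def KeptCell.point (C : KeptCell K d) : G.Vertex := C.1.2.choose

theorem KeptCell.toResidue_point (C : KeptCell K d) : toResidue {d}ᶜ C.point = C.1 :=
  Subtype.ext C.1.2.choose_spec.symm

theorem KeptCell.point_mem (C : KeptCell K d) : C.point ∈ K :=
  C.2 (mem_iff_toResidue_eq.2 C.toResidue_point)

/-- The values at the chosen vertices of the cells. -/
noncomputable def pointValues (K : Finset G.Vertex) (d : Color) :
    (K → ZMod 2) →ₗ[ZMod 2] (KeptCell K d → ZMod 2) where
  toFun x C := extendZero x C.point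
  map_add' x y := by funext C; exact extendZero_add _ _ _
  map_smul' a x := by funext C; exact extendZero_smul _ _ _

theorem toResidue_compl_nbr {i : Color} (hi : i ≠ d) (v : G.Vertex) :
    toResidue {d}ᶜ (G.nbr i v) = toResidue {d}ᶜ v :=
  toResidue_nbr (by simpa using hi) v

theorem extendZero_congr {x x' : K → ZMod 2} {v : G.Vertex}
    (h : ∀ q : K, toResidue {d}ᶜ q.1 = toResidue {d}ᶜ v → x q = x' q) :
    extendZero x v = extendZero x' v := by
  by_cases hv : v ∈ K
  · simp only [extendZero, hv, dif_pos]
    exact h ⟨v, hv⟩ rfl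
  · rw [extendZero_of_notMem _ hv, extendZero_of_notMem _ hv]

/-- Vectors without edge sums and values at the chosen vertices vanish. -/
theorem eq_zero_of_edgeSums (hK : G.CutsOnly d K) {x : K → ZMod 2} (h1 : edgeSums K d x = 0)
    (h2 : pointValues K d x = 0) : x = 0 := by
  funext q
  have hq : G.residue {d}ᶜ q.1 ⊆ (K : Set G.Vertex) := hK.residue_subset (by simp) q.2
  let C : KeptCell K d := ⟨toResidue {d}ᶜ q.1, hq⟩
  have hC : extendZero x C.point = 0 := congrFun h2 C
  -- The zero value at the chosen vertex spreads along the edges of the cell, because the edge sums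
  -- vanish.
  have hsub : G.residue {d}ᶜ C.point ⊆ {w | w ∈ K ∧ extendZero x w = 0} := by
    refine residue_subset ⟨C.point_mem, hC⟩ ?_
    rintro c hc w ⟨hw, hw0⟩
    have hcd : c ≠ d := by simpa using hc
    refine ⟨hK.nbr_mem hcd hw, ?_⟩
    have := congrFun h1 (edgeQubit hK hcd hw)
    rw [edgeSums_edgeQubit, hw0, zero_add] at this
    exact this
  have hmem : q.1 ∈ G.residue {d}ᶜ C.point := by
    have : G.residue {d}ᶜ C.point = G.residue {d}ᶜ q.1 := congrArg Subtype.val C.toResidue_point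
    rw [this]
    exact mem_residue_self _ _
  have := (hsub hmem).2
  rwa [extendZero_coe] at this

/-! ### The `X`-stabilizers -/

/-- The `X`-stabilizer of the toric codes at the cell `C` of color `i`. -/
noncomputable def vertexCheck (K : Finset G.Vertex) (d i : Color) (C : Set G.Vertex) :
    G.ToricQubit K d → ZMod 2 :=
  fun r => if r.1.1 = i then ((C ∩ qubitEdge r).ncard : ZMod 2) else 0

theorem vertexCheck_mem (i : Color) (hi : i ≠ d) (C : G.Residue {i}ᶜ) :
    vertexCheck K d i C.1 ∈ (G.threeSmoothToricCodes K d).xChecks := by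
  refine ⟨⟨i, hi⟩, _, ⟨C, rfl⟩, fun e => if_pos rfl, ?_⟩
  rintro ⟨j, hj⟩ hne e
  exact if_neg fun h => hne (Subtype.ext h)

theorem eq_vertexCheck {w : G.ToricQubit K d → ZMod 2}
    (hw : w ∈ (G.threeSmoothToricCodes K d).xChecks) :
    ∃ (i : Color) (C : G.Residue {i}ᶜ), w = vertexCheck K d i C.1 := by
  obtain ⟨⟨i, hi⟩, _, ⟨C, rfl⟩, h1, h2⟩ := hw
  refine ⟨i, C, ?_⟩
  funext ⟨⟨j, hj⟩, e⟩
  by_cases h : j = i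
  · subst h
    exact (h1 e).trans (if_pos rfl).symm
  · exact (h2 ⟨j, hj⟩ (fun e => h (congrArg Subtype.val e)) e).trans (if_neg h).symm

open Classical in
theorem ncard_inter_edge (A : Set G.Vertex) (i : Color) (v : G.Vertex) :
    ((A ∩ G.residue {i} v).ncard : ZMod 2) =
      (if v ∈ A then 1 else 0) + if G.nbr i v ∈ A then 1 else 0 := by
  have h := sum_edge i v fun w => if w ∈ A then (1 : ZMod 2) else 0
  rw [← h, Set.ncard_eq_toFinset_card', Finset.card_eq_sum_ones, Nat.cast_sum, Nat.cast_one,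
    ← Finset.sum_filter, ← Finset.sum_filter, Finset.filter_filter]
  refine Finset.sum_congr ?_ fun _ _ => rfl
  ext w
  simp [toResidue, and_comm]

open Classical in
theorem extendZero_restrict (A : Set G.Vertex) {v : G.Vertex} (hv : v ∈ K) :
    extendZero (G.restrict K A) v = if v ∈ A then 1 else 0 := by
  simp only [extendZero, hv, dif_pos, restrict, charVec_apply]

/-- An edge of a color other than `c` has both ends or neither in a `c`-cell, so only `c`-edges can
see its boundary. For `c = d` nothing remains. -/
theorem edgeSums_restrict_cell (hK : G.CutsOnly d K) (c : Color) (v : G.Vertex) :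
    edgeSums K d (G.restrict K (G.cell c v)) = vertexCheck K d c (G.cell c v) := by
  classical
  funext r
  obtain ⟨i, hi, u, hu, rfl⟩ := exists_eq_edgeQubit hK r
  rw [edgeSums_edgeQubit, extendZero_restrict _ hu, extendZero_restrict _ (hK.nbr_mem hi hu)]
  change _ = if i = c then ((G.cell c v ∩ G.residue {i} u).ncard : ZMod 2) else 0
  by_cases h : i = c
  · rw [if_pos h, ncard_inter_edge]
  · have hmem : i ∈ ({c}ᶜ : Finset Color) := by simpa using h
    have : G.nbr i u ∈ G.cell c v ↔ u ∈ G.cell c v :=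
      ⟨fun hm => by simpa [G.nbr_nbr] using nbr_mem_residue hmem hm, nbr_mem_residue hmem⟩
    rw [if_neg h]
    simp only [this]
    exact CharTwo.add_self_eq_zero _

theorem edgeSums_mem_span (hK : G.CutsOnly d K) {x : K → ZMod 2}
    (hx : x ∈ (G.xBoundaryCode K).xChecks) :
    edgeSums K d x ∈ Submodule.span (ZMod 2) (G.threeSmoothToricCodes K d).xChecks := by
  obtain ⟨c, v, -, rfl⟩ := hx
  rw [edgeSums_restrict_cell hK]
  by_cases hc : c = d
  · have : vertexCheck K d c (G.cell c v) = 0 := by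
      funext r
      exact if_neg fun h => r.1.2 (h.trans hc)
    rw [this]
    exact zero_mem _
  · exact Submodule.subset_span (vertexCheck_mem c hc (toResidue {c}ᶜ v))

theorem exists_edgeSums_eq_vertexCheck (hK : G.CutsOnly d K) {y : G.ToricQubit K d → ZMod 2}
    (hy : y ∈ (G.threeSmoothToricCodes K d).xChecks) :
    ∃ x ∈ Submodule.span (ZMod 2) (G.xBoundaryCode K).xChecks, edgeSums K d x = y := by
  obtain ⟨i, C, rfl⟩ := eq_vertexCheck hy
  by_cases hm : ∃ v ∈ K, v ∈ C.1
  · obtain ⟨v, hv, hvC⟩ := hm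
    have e : G.cell i v = C.1 := congrArg Subtype.val (mem_iff_toResidue_eq.1 hvC)
    refine ⟨_, Submodule.subset_span ⟨i, v, hv, rfl⟩, ?_⟩
    rw [edgeSums_restrict_cell hK, e]
  · push Not at hm
    -- The toric code has a generator for every cell of the whole lattice; for a cell that misses
    -- `K` it is the zero vector.
    refine ⟨0, zero_mem _, ?_⟩
    rw [map_zero]
    funext r
    have : C.1 ∩ qubitEdge r = ∅ := by
      refine Set.eq_empty_of_forall_notMem fun v hv => hm v ?_ hv.1
      exact (r.2.2 : qubitEdge r ⊆ K) hv.2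
    simp [vertexCheck, this]

/-- The witness takes the value `w C` throughout each kept cell `C`. It is a sum of `d`-cell
stabilizers, and these are what become the `|+⟩` ancillas. -/
theorem exists_pointValues_eq (hK : G.CutsOnly d K) (w : KeptCell K d → ZMod 2) :
    ∃ x ∈ Submodule.span (ZMod 2) (G.xBoundaryCode K).xChecks,
      edgeSums K d x = 0 ∧ pointValues K d x = w := by
  classical
  have hcell : ∀ {v}, v ∈ K → (toResidue {d}ᶜ v).1 ⊆ (K : Set G.Vertex) := fun hv =>
    hK.residue_subset (by simp) hv
  let x : K → ZMod 2 := fun q => w ⟨toResidue {d}ᶜ q.1, hcell q.2⟩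
  have hx : ∀ {v} (hv : v ∈ K), extendZero x v = w ⟨toResidue {d}ᶜ v, hcell hv⟩ := fun hv => by
    simp only [extendZero, hv, dif_pos]; rfl
  refine ⟨x, ?_, ?_, ?_⟩
  · have : x = ∑ C : KeptCell K d, w C • G.restrict K C.1.1 := by
      funext q
      rw [Finset.sum_apply, Finset.sum_eq_single ⟨toResidue {d}ᶜ q.1, hcell q.2⟩]
      · have : q.1 ∈ (toResidue {d}ᶜ q.1).1 := mem_toResidue _ _
        simp [x, restrict, charVec_apply, this]
      · intro C _ hC
        have : q.1 ∉ C.1.1 := fun h => hC (Subtype.ext (mem_iff_toResidue_eq.1 h).symm)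
        simp [restrict, charVec_apply, this]
      · exact fun h => absurd (Finset.mem_univ _) h
    rw [this]
    refine Submodule.sum_mem _ fun C _ => Submodule.smul_mem _ _ (Submodule.subset_span ?_)
    refine ⟨d, C.point, C.point_mem, ?_⟩
    rw [← C.toResidue_point]
    rfl
  · funext r
    obtain ⟨i, hi, u, hu, rfl⟩ := exists_eq_edgeQubit hK r
    rw [edgeSums_edgeQubit, hx hu, hx (hK.nbr_mem hi hu)]
    simp only [toResidue_compl_nbr hi]
    exact CharTwo.add_self_eq_zero _
  · funext C
    change extendZero x C.point = _
    rw [hx C.point_mem]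
    congr 1
    exact Subtype.ext C.toResidue_point

/-! ### The `Z`-stabilizers -/

open Classical in
/-- The values of a vector of qubits on the `i`-colored edges, extended by zero. -/
noncomputable def edgeValues (y : G.ToricQubit K d → ZMod 2) (i : Color) (hi : i ≠ d)
    (e : G.Residue {i}) : ZMod 2 :=
  if h : e.1 ⊆ (K : Set G.Vertex) then y ⟨⟨i, hi⟩, ⟨e, h⟩⟩ else 0

open Classical in
theorem sum_edgeValues {y w : G.ToricQubit K d → ZMod 2} {i : Color} (hi : i ≠ d)
    {A : Set G.Vertex} (hw : ∀ e, w ⟨⟨i, hi⟩, e⟩ = if qubitEdge ⟨⟨i, hi⟩, e⟩ ⊆ A then 1 else 0)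
    (hw' : ∀ j, j ≠ ⟨i, hi⟩ → ∀ e, w ⟨j, e⟩ = 0) :
    w ⬝ᵥ y = ∑ e : G.Residue {i}, if e.1 ⊆ A then edgeValues y i hi e else 0 := by
  let f : {e : G.Residue {i} // e.1 ⊆ (K : Set G.Vertex)} → G.ToricQubit K d :=
    fun e => ⟨⟨i, hi⟩, e⟩
  have hf : Function.Injective f := fun a b h => by
    have := (Sigma.mk.inj h).2
    exact eq_of_heq this
  have h1 : ∑ e, w (f e) * y (f e) = ∑ r, w r * y r := by
    refine Finset.sum_of_injOn f hf.injOn (by simp) ?_ (fun _ _ => rfl)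
    rintro ⟨j, e⟩ _ hr
    have : j ≠ ⟨i, hi⟩ := by
      rintro rfl
      exact hr ⟨e, Finset.mem_coe.2 (Finset.mem_univ _), rfl⟩
    rw [hw' j this, zero_mul]
  rw [dotProduct, ← h1]
  refine Finset.sum_of_injOn Subtype.val Subtype.val_injective.injOn (by simp) ?_ ?_
  · intro e _ he
    have : ¬ e.1 ⊆ (K : Set G.Vertex) := fun h => he ⟨⟨e, h⟩, by simp, rfl⟩
    rw [edgeValues, dif_neg this, ite_self]
  · rintro ⟨e, he⟩ _
    have h2 := hw ⟨e, he⟩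
    change w ⟨⟨i, hi⟩, ⟨e, he⟩⟩ * y ⟨⟨i, hi⟩, ⟨e, he⟩⟩ = _
    rw [h2, edgeValues, dif_pos he, ite_mul, one_mul, zero_mul]
    rfl

/-- The `i`-edges of a plaquette cover all its vertices, so the toric and the color code agree on
which faces are intact. -/
theorem face_subset_iff {P : Finset Color} {i : Color} (hi : i ∈ P) (F : G.Residue P) :
    (∀ e : G.Residue {i}, e.1 ⊆ F.1 → e.1 ⊆ (K : Set G.Vertex)) ↔ F.1 ⊆ (K : Set G.Vertex) := by
  refine ⟨fun h v hv => h (toResidue {i} v) ?_ (mem_toResidue _ _), fun h e he => he.trans h⟩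
  exact (residue_subset_iff (by simpa using hi)).2 (mem_iff_toResidue_eq.1 hv)

open Classical in
/-- The vectors that commute with all `Z`-stabilizers of the toric codes are the cocycles. -/
theorem dotProduct_toric_zChecks_iff (y : G.ToricQubit K d → ZMod 2) :
    (∀ z ∈ (G.threeSmoothToricCodes K d).zChecks, z ⬝ᵥ y = 0) ↔
      ∀ (i : Color) (hi : i ≠ d) (P : Finset Color), P.card = 2 → i ∈ P → ∀ F : G.Residue P,
        F.1 ⊆ (K : Set G.Vertex) →
        (∑ e : G.Residue {i}, if e.1 ⊆ F.1 then edgeValues y i hi e else 0) = 0 := by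
  constructor
  · intro h i hi P hP hiP F hF
    let w : G.ToricQubit K d → ZMod 2 := fun r => if r.1.1 = i ∧ qubitEdge r ⊆ F.1 then 1 else 0
    have hw : ∀ e, w ⟨⟨i, hi⟩, e⟩ = if qubitEdge ⟨⟨i, hi⟩, e⟩ ⊆ F.1 then 1 else 0 := fun e => by
      simp [w]
    have hw' : ∀ j, j ≠ ⟨i, hi⟩ → ∀ e, w ⟨j, e⟩ = 0 := fun j hj e =>
      if_neg fun h => hj (Subtype.ext h.1)
    rw [← sum_edgeValues hi hw hw']
    refine h w ⟨⟨i, hi⟩, _, ⟨⟨⟨P, hP, hiP⟩, F⟩, (face_subset_iff hiP F).2 hF, rfl⟩, ?_, hw'⟩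
    intro e
    rw [hw, charVec_apply]
    rfl
  · rintro h z ⟨⟨i, hi⟩, _, ⟨⟨⟨P, hP, hiP⟩, F⟩, hF, rfl⟩, h1, h2⟩
    rw [sum_edgeValues (A := F.1) hi (fun e => ?_) h2]
    · exact h i hi P hP hiP F ((face_subset_iff hiP F).1 hF)
    · exact (h1 e).trans (charVec_apply _ _)

/-- The `i`-edges of a plaquette partition its vertices, so the face sum of the coboundary is the
plaquette sum of `x`. A plaquette without color `d` is a face in two of the copies, and both
conditions pull back to the same one. -/
theorem dotProduct_edgeSums_iff (x : K → ZMod 2) :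
    (∀ z ∈ (G.threeSmoothToricCodes K d).zChecks, z ⬝ᵥ edgeSums K d x = 0) ↔
      ∀ z ∈ (G.xBoundaryCode K).zChecks, z ⬝ᵥ x = 0 := by
  classical
  have key : ∀ (i : Color) (hi : i ≠ d) (P : Finset Color), i ∈ P → ∀ F : G.Residue P,
      F.1 ⊆ (K : Set G.Vertex) →
      (∑ e : G.Residue {i}, if e.1 ⊆ F.1 then edgeValues (edgeSums K d x) i hi e else 0) =
        G.restrict K F.1 ⬝ᵥ x := by
    intro i hi P hiP F hF
    have h1 := sum_residue {i} (fun e => e.1 ⊆ F.1) (extendZero x)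
    have h2 : ∀ v, (toResidue {i} v).1 ⊆ F.1 ↔ v ∈ F.1 := fun v => by
      rw [mem_iff_toResidue_eq]
      exact residue_subset_iff (by simpa using hiP)
    simp only [h2] at h1
    rw [restrict_dotProduct, ← h1]
    refine Finset.sum_congr rfl fun e _ => ?_
    by_cases he : e.1 ⊆ F.1
    · rw [if_pos he, if_pos he, edgeValues, dif_pos (he.trans hF), ← restrict_dotProduct]
      rfl
    · rw [if_neg he, if_neg he]
  rw [dotProduct_toric_zChecks_iff]
  constructor
  · rintro h _ ⟨P, hP, v, hv, rfl⟩
    -- One of the two edge colors differs from `d`, so the plaquette is a face of at least one copy.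
    obtain ⟨i, hiP, hi⟩ := Finset.exists_mem_ne (by omega : 1 < P.card) d
    rw [← h i hi P hP hiP (toResidue P v) hv, key i hi P hiP (toResidue P v) hv]
    rfl
  · intro h i hi P hP hiP F hF
    rw [key i hi P hiP F hF]
    obtain ⟨v, rfl⟩ := exists_eq_toResidue F
    exact h _ ⟨P, hP, v, hF, rfl⟩

/-! ### Solving the toric face conditions, and the equivalence of the codes -/

theorem Color.exists_two {i d : Color} (hi : i ≠ d) : ∃ j k, [i, j, k, d].Nodup := by
  revert i d; decide

/-- Exactness on the spherical cell surfaces gives a potential `γ i` for each copy separately. It is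
constant along the other two colors, so the potentials can be superposed without disturbing one
another. -/
theorem exists_edgeSums_eq (hG : G.IsColorCodeLattice) (hK : G.CutsOnly d K)
    (y : G.ToricQubit K d → ZMod 2)
    (hy : ∀ z ∈ (G.threeSmoothToricCodes K d).zChecks, z ⬝ᵥ y = 0) :
    ∃ x, edgeSums K d x = y := by
  classical
  rw [dotProduct_toric_zChecks_iff] at hy
  have hpot : ∀ i : {i : Color // i ≠ d}, ∃ γ : G.Vertex → ZMod 2,
      (∀ c, c ≠ i.1 → c ≠ d → ∀ v, γ (G.nbr c v) = γ v) ∧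
      ∀ v, edgeValues y i.1 i.2 (toResidue {i.1} v) = γ v + γ (G.nbr i.1 v) := by
    rintro ⟨i, hi⟩
    obtain ⟨j, k, hnd⟩ := Color.exists_two hi
    obtain ⟨hij, hik, -, hjk, hjd, hkd⟩ := Color.ne_of_nodup hnd
    have hface : ∀ l, l ≠ i → l ≠ d → ∀ F : G.Residue {i, l},
        (∑ e : G.Residue {i}, if e.1 ⊆ F.1 then edgeValues y i hi e else 0) = 0 := by
      intro l hli hld F
      by_cases hF : F.1 ⊆ (K : Set G.Vertex)
      · exact hy i hi _ (Finset.card_pair hli.symm) (by simp) F hF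
      -- A plaquette without `d`-colored edges that is not inside `K` is disjoint from it, so
      -- extending by zero preserves the cocycle condition on the whole lattice.
      · refine Finset.sum_eq_zero fun e _ => ?_
        by_cases he : e.1 ⊆ F.1
        · rw [if_pos he, edgeValues, dif_neg]
          intro heK
          obtain ⟨v, rfl⟩ := exists_eq_toResidue e
          have hvF := mem_iff_toResidue_eq.1 (he (mem_toResidue _ v))
          refine hF ?_
          rw [← hvF]
          exact hK.residue_subset (by simp [hi.symm, hld.symm]) (heK (mem_toResidue _ v))
        · rw [if_neg he]
    obtain ⟨g, hg⟩ := hG.exists_potential hnd (edgeValues y i hi) (hface j hij.symm hjd)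
      (hface k hik.symm hkd)
    refine ⟨fun v => g (toResidue {j, k} v), fun c hci hcd v => ?_, hg⟩
    rcases Color.eq_or hnd c with rfl | rfl | rfl | rfl
    · exact absurd rfl hci
    · exact congrArg g (toResidue_nbr (by simp) v)
    · exact congrArg g (toResidue_nbr (by simp) v)
    · exact absurd rfl hcd
  choose γ hγ hγy using hpot
  have hx : ∀ {v} (_ : v ∈ K), extendZero (fun q : K => ∑ i, γ i q.1) v = ∑ i, γ i v :=
    fun hv => by simp only [extendZero, hv, dif_pos]
  refine ⟨fun q => ∑ i, γ i q.1, ?_⟩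
  funext r
  obtain ⟨i, hi, u, hu, rfl⟩ := exists_eq_edgeQubit hK r
  rw [edgeSums_edgeQubit, hx hu, hx (hK.nbr_mem hi hu), ← Finset.sum_add_distrib,
    Finset.sum_eq_single ⟨i, hi⟩]
  · rw [← hγy, edgeValues, dif_pos (hK.edge_subset hi hu)]
    rfl
  · intro j _ hj
    rw [hγ j i (fun e => hj (Subtype.ext e.symm)) hi]
    exact CharTwo.add_self_eq_zero _
  · simp

/-- The `X`-boundary code is three copies of the toric code with smooth boundary. -/
theorem locallyEquivalent_threeSmoothToricCodes (hG : G.IsColorCodeLattice)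
    (hK : G.CutsOnly d K) :
    LocallyEquivalent (G.localRegions K) 3 (fun q : K => {q}) (G.xBoundaryCode K)
      (G.toricLoc K d) (G.threeSmoothToricCodes K d) := by
  have hpos : ∀ v : K, v ∈ {w : K | w.1 ∈ (toResidue {d}ᶜ v.1).1} := fun v => mem_toResidue _ _
  -- The blocks are the `d`-cells. The edges of other colors do not leave them, so `edgeSums` and
  -- `pointValues` are local.
  refine locallyEquivalent_of_blockwise (Δ := KeptCell K d) (ι := G.Residue {d}ᶜ) _ _ _ _
    (fun q => toResidue {d}ᶜ q.1) (fun r => toResidue {d}ᶜ (qubitEnd r)) (fun C => C.1)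
    (fun C => {w | w.1 ∈ C.1}) ?_ ?_ ?_ id hpos
    (fun r => ⟨qubitEnd r, qubitEnd_mem r⟩) (fun r => hpos ⟨qubitEnd r, qubitEnd_mem r⟩)
    (fun C => ⟨C.point, C.point_mem⟩) (fun C => mem_iff_toResidue_eq.2 C.toResidue_point)
    (edgeSums K d) (pointValues K d) ?_ ?_ (fun x => eq_zero_of_edgeSums hK)
    (exists_pointValues_eq hK) (fun y => exists_edgeSums_eq_vertexCheck hK)
    (fun x => edgeSums_mem_span hK) dotProduct_edgeSums_iff (exists_edgeSums_eq hG hK)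
  · intro C
    obtain ⟨v, rfl⟩ := exists_eq_toResidue C
    exact ⟨d, v, rfl⟩
  · intro q
    exact Set.singleton_subset_iff.2 (hpos q)
  · intro r w hw
    have hw' : w.1 ∈ qubitEdge r := hw
    rw [qubitEdge_eq] at hw'
    exact residue_mono (by simpa using r.1.2.symm) _ hw'
  · intro x x' r h
    rw [edgeSums_apply, edgeSums_apply, extendZero_congr h,
      extendZero_congr (v := G.nbr r.1.1 (qubitEnd r))]
    intro q hq
    rw [toResidue_compl_nbr r.1.2] at hq
    exact h q hq
  · intro x x' C h
    refine extendZero_congr (d := d) fun q hq => h q ?_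
    rw [hq, C.toResidue_point]

end ColoredGraph

theorem mainTheorem2 :
    ∃ D : ℕ, ∀ (G : ColoredGraph.{u}), G.IsColorCodeLattice →
      ∀ (c₁ c₂ c₃ c₄ : Color), [c₁, c₂, c₃, c₄].Nodup →
      ∀ (K : Finset G.Vertex), G.CutsOnly c₄ K →
        -- the three membranes terminate on the boundary
        (∀ a b : Color, a ∈ [c₁, c₂, c₃] → b ∈ [c₁, c₂, c₃] → a ≠ b →
          ∀ M : Set (G.Residue {a, b}), G.XTerminates K (G.membrane a b M)) ∧
        -- the condensing excitations are exactly those generated by the three flux loops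
        ((∃ v, v ∉ K) → (∃ c, c ≠ c₄ ∧ ∃ v, G.residue {c, c₄} v ⊆ K) →
          G.condensationGroup K =
            AddSubgroup.closure {ColoredGraph.fluxLoop c₂ c₃, ColoredGraph.fluxLoop c₁ c₃,
              ColoredGraph.fluxLoop c₁ c₂}) ∧
        -- equivalence with three toric codes with smooth boundaries
        LocallyEquivalent (G.localRegions K) D
          (fun q : K => {q}) (G.xBoundaryCode K)
          (G.toricLoc K c₄) (G.threeSmoothToricCodes K c₄) :=
  -- The depth 3 counts the two shears and the layer of Hadamard gates.
  ⟨3, fun _ hG _ _ _ _ h _ hK => ⟨fun _ _ _ _ _ _ => ColoredGraph.xTerminates _,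
    ColoredGraph.condensationGroup_eq hG h hK,
    ColoredGraph.locallyEquivalent_threeSmoothToricCodes hG hK⟩⟩
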